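/- There is a universal constant $C>0$ such that the following holds. Let $P$ be a probability distribution on $\mathcal X\times\mathcal Y$, let $\mathcal G$ be a set of prediction functions $g:\mathcal X\to\mathcal Y$ carrying a probability distribution $\pi$, and let $\ell:\mathcal Y\times\mathcal Y\to[0,1]$ be a loss function (for instance the classification loss $\ell(y,y')=\mathbb 1_{y\ne y'}$); the $\sigma$-algebra on $\mathcal G$ is such that $(g,x)\mapsto g(x)$ is measurable, $\ell$ is measurable, and the diagonal of $\mathcal Y$ is measurable. Let $n\ge 1$, let $\varepsilon>0$, and let $Z_1=(X_1,Y_1),\dots,Z_n=(X_n,Y_n)$ be i.i.d. with law $P$. Put $R(g)=\mathbb E_{(X,Y)\sim P}\,\ell(Y,g(X))$, $r(g)=\frac1n\sum_{m=1}^n\ell(Y_m,g(X_m))$ and $$V(g_1,g_2)=\frac1n\sum_{m=1}^n\big[\ell(Y_m,g_1(X_m))-\ell(Y_m,g_2(X_m))\big]^2 .$$ For $h:\mathcal G\to\mathbb R$ bounded and measurable, let $\pi_h(dg)=\frac{e^{h(g)}}{\mathbb E_{g'\sim\pi}e^{h(g')}}\,\pi(dg)$. Let $\Psi(t)=\frac{e^t-1-t}{t^2}$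 and, for $\lambda>0$, $$a(\lambda)=\tfrac{\lambda}{n}\Psi\big(\tfrac{\lambda}{n}\big)\big(1+\tfrac{\lambda}{2n}\big),\qquad b(\lambda)=\tfrac{2}{\lambda}\Big[1+\tfrac{\lambda}{n}\Psi\big(\tfrac{\lambda}{n}\big)\big(1+\tfrac{\lambda}{2n}\big)^2\Big].$$ For integers $0\le j\le\log n$ let $$\lambda_j=0.19\sqrt n\,e^{j/2},\qquad \mathcal C(j)=\log\mathbb E_{g_1\sim\pi_{-\lambda_jr}}\exp\Big(\tfrac{4\lambda_j^2}{n}\,\mathbb E_{g_2\sim\pi_{-\lambda_jr}}V(g_1,g_2)\Big),\qquad L=\log\big[3\log^2(en)\,\varepsilon^{-1}\big],$$ and for integers $0\le i<j\le\log n$ let $$S(i,j)=a(\lambda_j)\,\mathbb E_{g_1\sim\pi_{-\lambda_ir}}\mathbb E_{g_2\sim\pi_{-\lambda_jr}}V(g_1,g_2)+b(\lambda_j)\big[\mathcal C(i)+\mathcal C(j)+2L\big].$$ Consider the following iterative scheme: $u(0)=0$ and, for $k\ge1$, $u(k)$ is the smallest integer $j$ with $u(k-1)<j\le\log n$ and $$\mathbb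 E_{g\sim\pi_{-\lambda_jr}}r(g)-\mathbb E_{g\sim\pi_{-\lambda_{u(k-1)}r}}r(g)+S\big(u(k-1),j\big)\le0,$$ if there is one; otherwise $u(k)$ does not exist and the scheme stops. Write $\hat\lambda_k=\lambda_{u(k)}$. Then the scheme is finite: for every sample there is $K\in\mathbb N$ such that $u(K)$ exists but $u(K+1)$ does not. Moreover, with probability at least $1-\varepsilon$ over the sample, both of the following hold. For every $k\in\{1,\dots,K\}$, $$\mathbb E_{g\sim\pi_{-\hat\lambda_kr}}R(g)\le\mathbb E_{g\sim\pi_{-\hat\lambda_{k-1}r}}R(g),$$ and $$\mathbb E_{g\sim\pi_{-\hat\lambda_Kr}}R(g)\le\min_{1\le j\le\log n}\bigg\{\mathbb E_{g\sim\pi_{-\lambda_{j-1}R}}R(g)+C\,\frac{\log[\log(en)\varepsilon^{-1}]}{\lambda_j}+\frac1{\lambda_j}\sup_{0\le i\le j}\log\mathbb E_{g_1\sim\pi_{-\lambda_iR}}\mathbb E_{g_2\sim\pi_{-\lambda_iR}}\,e^{\frac{C\lambda_i^2}{n}\mathbb P[g_1(X)\ne g_2(X)]}\bigg\},$$ where the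 minimum over an empty set of $j$ (the case $\log n<1$) is $+\infty$. -/

import Mathlib

open MeasureTheory

noncomputable section

namespace GibbsSelection

variable {X Y G : Type*} [MeasurableSpace X] [MeasurableSpace Y] [MeasurableSpace G]

/-! Prediction functions are given as a family `f : G → X → Y` indexed by a measurable space `G`
(for a set of functions, `f` is the inclusion); `l y y'` is the loss of predicting `y'` when the
true output is `y`; a sample of size `n` is a map `z : Fin n → X × Y`. -/

/-- The risk `R(g) = 𝔼_{(X,Y) ∼ P} l(Y, g(X))`. -/
def risk (P : Measure (X × Y)) (l : Y → Y → ℝ) (f : G → X → Y) (g : G) : ℝ :=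
  ∫ p, l p.2 (f g p.1) ∂P

/-- The empirical risk `r(g) = (1/n) ∑ l(Yᵢ, g(Xᵢ))`. -/
def empRisk {X Y G : Type*} (l : Y → Y → ℝ) (f : G → X → Y) {n : ℕ} (z : Fin n → X × Y)
    (g : G) : ℝ :=
  (1 / (n : ℝ)) * ∑ i, l (z i).2 (f g (z i).1)

/-- The empirical quadratic distance `(1/n) ∑ [l(Yᵢ, g₁(Xᵢ)) - l(Yᵢ, g₂(Xᵢ))]²`. -/
def empSqDist {X Y G : Type*} (l : Y → Y → ℝ) (f : G → X → Y) {n : ℕ} (z : Fin n → X × Y)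
    (g₁ g₂ : G) : ℝ :=
  (1 / (n : ℝ)) * ∑ i, (l (z i).2 (f g₁ (z i).1) - l (z i).2 (f g₂ (z i).1)) ^ 2

/-- The probability of disagreement `ℙ[g₁(X) ≠ g₂(X)]`. -/
def disagreement (P : Measure (X × Y)) (f : G → X → Y) (g₁ g₂ : G) : ℝ :=
  P.real {p | f g₁ p.1 ≠ f g₂ p.1}

/-- The Gibbs distribution `π_{-lam h}(dg) = e^{-lam h(g)} / 𝔼_{g' ∼ π} e^{-lam h(g')} · π(dg)`. -/
def gibbs (π : Measure G) (h : G → ℝ) (lam : ℝ) : Measure G :=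
  π.tilted (fun g => -lam * h g)

/-- The grid of inverse temperatures `λ_j = 0.19 √n e^{j/2}`. -/
def invTemp (n j : ℕ) : ℝ := 0.19 * Real.sqrt n * Real.exp ((j : ℝ) / 2)

/-- `Ψ(t) = (eᵗ - 1 - t) / t²` (used for `t > 0` only). -/
def psi (t : ℝ) : ℝ := (Real.exp t - 1 - t) / t ^ 2

/-- `a(lam) = (lam/n) Ψ(lam/n) (1 + lam/(2n))`. -/
def coefA (n : ℕ) (lam : ℝ) : ℝ := lam / n * psi (lam / n) * (1 + lam / (2 * n))

/-- `b(lam) = (2/lam) [1 + (lam/n) Ψ(lam/n) (1 + lam/(2n))²]`. -/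
def coefB (n : ℕ) (lam : ℝ) : ℝ :=
  2 / lam * (1 + lam / n * psi (lam / n) * (1 + lam / (2 * n)) ^ 2)

/-- `L = log[3 log²(en) ε⁻¹]`. -/
def confTerm (n : ℕ) (ε : ℝ) : ℝ := Real.log (3 * Real.log (Real.exp 1 * n) ^ 2 * ε⁻¹)

/-- The posterior `π_{-λ_j r}`. -/
def posterior (π : Measure G) (l : Y → Y → ℝ) (f : G → X → Y) {n : ℕ} (z : Fin n → X × Y)
    (j : ℕ) : Measure G :=
  gibbs π (empRisk l f z) (invTemp n j)

/-- The localized prior `π_{-λ_j R}`, for samples of size `n`. -/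
def localPrior (π : Measure G) (P : Measure (X × Y)) (l : Y → Y → ℝ) (f : G → X → Y)
    (n j : ℕ) : Measure G :=
  gibbs π (risk P l f) (invTemp n j)

/-- The empirical complexity `𝒞(j)`. -/
def complexity (π : Measure G) (l : Y → Y → ℝ) (f : G → X → Y) {n : ℕ} (z : Fin n → X × Y)
    (j : ℕ) : ℝ :=
  Real.log (∫ g₁, Real.exp (4 * invTemp n j ^ 2 / n *
    ∫ g₂, empSqDist l f z g₁ g₂ ∂(posterior π l f z j)) ∂(posterior π l f z j))

/-- The empirical comparison term `S(i, j)`. -/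
def compTerm (π : Measure G) (l : Y → Y → ℝ) (f : G → X → Y) (ε : ℝ) {n : ℕ}
    (z : Fin n → X × Y) (i j : ℕ) : ℝ :=
  coefA n (invTemp n j) *
      (∫ g₁, ∫ g₂, empSqDist l f z g₁ g₂ ∂(posterior π l f z j) ∂(posterior π l f z i))
    + coefB n (invTemp n j) *
      (complexity π l f z i + complexity π l f z j + 2 * confTerm n ε)

/-- The integers `j ∈ ]i; log n]` for which
`𝔼_{π_{-λ_j r}} r - 𝔼_{π_{-λ_i r}} r + S(i, j) ≤ 0`. -/
def candidates (π : Measure G) (l : Y → Y → ℝ) (f : G → X → Y) (ε : ℝ) {n : ℕ}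
    (z : Fin n → X × Y) (i : ℕ) : Set ℕ :=
  {j | i < j ∧ (j : ℝ) ≤ Real.log n ∧
    (∫ g, empRisk l f z g ∂(posterior π l f z j))
      - (∫ g, empRisk l f z g ∂(posterior π l f z i)) + compTerm π l f ε z i j ≤ 0}

/-- `u 0, …, u K` is the complete run of the selection scheme on the sample `z`: `u 0 = 0`, each
`u (k + 1)` is the smallest candidate after `u k`, and no candidate is left after `u K` (so that
`u K` exists and `u (K + 1)` does not; the values of `u` beyond `K` are irrelevant). -/
structure IsRun (π : Measure G) (l : Y → Y → ℝ) (f : G → X → Y) (ε : ℝ) {n : ℕ}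
    (z : Fin n → X × Y) (K : ℕ) (u : ℕ → ℕ) : Prop where
  start : u 0 = 0
  step : ∀ k < K, IsLeast (candidates π l f ε z (u k)) (u (k + 1))
  stop_at : candidates π l f ε z (u K) = ∅

/-- `log 𝔼_{g₁ ∼ π_{-λ_i R}} 𝔼_{g₂ ∼ π_{-λ_i R}} exp((C λ_i² / n) ℙ[g₁(X) ≠ g₂(X)])`. -/
def logLaplace (π : Measure G) (P : Measure (X × Y)) (l : Y → Y → ℝ) (f : G → X → Y)
    (n : ℕ) (C : ℝ) (i : ℕ) : ℝ :=
  Real.log (∫ g₁, ∫ g₂, Real.exp (C * invTemp n i ^ 2 / n * disagreement P f g₁ g₂)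
    ∂(localPrior π P l f n i) ∂(localPrior π P l f n i))

end GibbsSelection

end

/-! The argument is PAC-Bayesian with localized priors. Write μ_i = π_{-λ_i R} (not random), ρ_i =
π_{-λ_i r}, and d = R - r. Then ρ_i is μ_i tilted by λ_i d. By the Donsker-Varadhan inequality
(`integral_tilted_le`, and `integral_integral_tilted_le` for pairs), an exponential moment bounded
under the priors bounds the mean under the posteriors, at the price of their divergences. Fubini and
Markov turn three moment bounds (Bernstein for relative risks, lower and upper deviations of V) into
an event for each pair of grid points. Their intersection `GoodSample` has probability at least 1 -
ε, and everything after that is deterministic.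

First, KL(ρ_i, μ_i) has an empirical bound, 2𝒞(i) + L (`Deviation.klTilt_le`): the symmetrized
divergence equals λ_i times the difference of the means of d under ρ_i and μ_i, which Bernstein
controls by V, and V is paid for by the reverse divergence and 𝒞(i). With this, the means of d under
ρ_i and ρ_j differ by at most S(i,j) (`GoodSample.abs_riskGap_sub_le`), so every accepted step
decreases R.

If j is rejected at i, the empirical gain of j over i is less than S(i,j). Since V is itself bounded
by that gain plus 𝒞(j), the term S(i,j) is of the order of the complexities and L divided by λ_j,
and ρ_i is almost as good as ρ_j (`GoodSample.risk_le_of_notMem_candidates`). A run either selects a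
given j or rejects it at some i < j, and monotonicity transfers the bound to the final temperature.

It remains to remove the sample from the right-hand side: `Deviation.lgm_empSqDist_le` bounds 𝒞 by a
log-Laplace transform under the localized prior, and `Deviation.risk_tilted_le` compares ρ_j with
μ_{j-1}, using that consecutive temperatures have the fixed ratio √e. -/

namespace GibbsSelection

/-! ### Bounded measurable functions -/

/-- Bounded measurable real functions. -/
structure BddMeas {α : Type*} [MeasurableSpace α] (h : α → ℝ) : Prop where
  meas : Measurable h
  bdd : ∃ C, ∀ x, |h x| ≤ C

section BddMeas

variable {α β : Type*} [MeasurableSpace α] [MeasurableSpace β] {h k : α → ℝ}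

lemma BddMeas.const (c : ℝ) : BddMeas (fun _ : α => c) :=
  ⟨measurable_const, |c|, fun _ => le_rfl⟩

lemma BddMeas.add (hh : BddMeas h) (hk : BddMeas k) : BddMeas (fun x => h x + k x) := by
  obtain ⟨C, hC⟩ := hh.bdd
  obtain ⟨D, hD⟩ := hk.bdd
  exact ⟨hh.meas.add hk.meas, C + D,
    fun x => (abs_add_le _ _).trans (add_le_add (hC x) (hD x))⟩

lemma BddMeas.const_mul (hh : BddMeas h) (c : ℝ) : BddMeas (fun x => c * h x) := by
  obtain ⟨C, hC⟩ := hh.bdd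
  exact ⟨hh.meas.const_mul c, |c| * C,
    fun x => by rw [abs_mul]; exact mul_le_mul_of_nonneg_left (hC x) (abs_nonneg c)⟩

lemma BddMeas.neg (hh : BddMeas h) : BddMeas (fun x => -h x) := by
  simpa using hh.const_mul (-1)

lemma BddMeas.sub (hh : BddMeas h) (hk : BddMeas k) : BddMeas (fun x => h x - k x) := by
  simpa [sub_eq_add_neg] using hh.add hk.neg

lemma BddMeas.mul (hh : BddMeas h) (hk : BddMeas k) : BddMeas (fun x => h x * k x) := by
  obtain ⟨C, hC⟩ := hh.bdd
  obtain ⟨D, hD⟩ := hk.bdd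
  exact ⟨hh.meas.mul hk.meas, C * D, fun x => by
    rw [abs_mul]
    exact mul_le_mul (hC x) (hD x) (abs_nonneg _) ((abs_nonneg _).trans (hC x))⟩

lemma BddMeas.exp (hh : BddMeas h) : BddMeas (fun x => Real.exp (h x)) := by
  obtain ⟨C, hC⟩ := hh.bdd
  exact ⟨hh.meas.exp, Real.exp C, fun x => by
    rw [abs_of_pos (Real.exp_pos _)]
    exact Real.exp_le_exp.2 ((le_abs_self _).trans (hC x))⟩

lemma BddMeas.sum {ι : Type*} (s : Finset ι) {h : ι → α → ℝ} (hh : ∀ i, BddMeas (h i)) :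
    BddMeas (fun x => ∑ i ∈ s, h i x) := by
  classical
  induction s using Finset.induction_on with
  | empty => simpa using BddMeas.const (α := α) 0
  | insert a s ha ih => simpa [Finset.sum_insert ha] using (hh a).add ih

lemma BddMeas.comp (hh : BddMeas h) {φ : β → α} (hφ : Measurable φ) :
    BddMeas (fun y => h (φ y)) := by
  obtain ⟨C, hC⟩ := hh.bdd
  exact ⟨hh.meas.comp hφ, C, fun y => hC _⟩

lemma BddMeas.integrable (hh : BddMeas h) (μ : Measure α) [IsFiniteMeasure μ] :
    Integrable h μ := by
  obtain ⟨C, hC⟩ := hh.bdd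
  exact Integrable.of_bound hh.meas.aestronglyMeasurable C (ae_of_all _ hC)

lemma BddMeas.integral {h : α → β → ℝ} (hh : BddMeas (fun p : α × β => h p.1 p.2))
    (ν : Measure β) [IsProbabilityMeasure ν] : BddMeas (fun a => ∫ b, h a b ∂ν) := by
  obtain ⟨C, hC⟩ := hh.bdd
  refine ⟨(hh.meas.stronglyMeasurable.integral_prod_right' (ν := ν)).measurable, C, fun a => ?_⟩
  simpa using norm_integral_le_of_norm_le_const (μ := ν) (f := h a)
    (ae_of_all _ fun b => hC (a, b))

lemma BddMeas.right {h : α → β → ℝ} (hh : BddMeas (fun p : α × β => h p.1 p.2)) (a : α) :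
    BddMeas (fun b => h a b) :=
  hh.comp (φ := fun b => (a, b)) (by fun_prop)

end BddMeas

/-! ### Log-Laplace transforms and tilted measures -/

/-- The log-Laplace transform `log ∫ e^h dμ`. -/
noncomputable def lgm {α : Type*} [MeasurableSpace α] (μ : Measure α) (h : α → ℝ) : ℝ :=
  Real.log (∫ x, Real.exp (h x) ∂μ)

/-- The Kullback-Leibler divergence of `μ.tilted φ` from `μ`. -/
noncomputable def klTilt {α : Type*} [MeasurableSpace α] (μ : Measure α) (φ : α → ℝ) : ℝ :=
  ∫ x, φ x ∂(μ.tilted φ) - lgm μ φ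

section lgm

variable {α β : Type*} [MeasurableSpace α] [MeasurableSpace β]
  {μ : Measure α} [IsProbabilityMeasure μ] {ν : Measure β} [IsProbabilityMeasure ν]
  {h k φ : α → ℝ}

lemma exp_lgm (hh : BddMeas h) : Real.exp (lgm μ h) = ∫ x, Real.exp (h x) ∂μ :=
  Real.exp_log (integral_exp_pos (hh.exp.integrable μ))

omit [IsProbabilityMeasure μ] in
lemma integral_exp_sub (h : α → ℝ) (c : ℝ) :
    ∫ x, Real.exp (h x - c) ∂μ = Real.exp (-c) * ∫ x, Real.exp (h x) ∂μ := by
  rw [← integral_const_mul]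
  congr 1 with x
  rw [← Real.exp_add]; congr 1; ring

lemma integral_exp_sub_lgm (hh : BddMeas h) : ∫ x, Real.exp (h x - lgm μ h) ∂μ = 1 := by
  rw [integral_exp_sub, ← exp_lgm hh, ← Real.exp_add]; simp

lemma lgm_le_iff (hh : BddMeas h) {c : ℝ} : lgm μ h ≤ c ↔ ∫ x, Real.exp (h x) ∂μ ≤ Real.exp c := by
  rw [← exp_lgm hh, Real.exp_le_exp]

lemma lgm_mono (hh : BddMeas h) (hk : BddMeas k) (hle : ∀ x, h x ≤ k x) : lgm μ h ≤ lgm μ k := by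
  rw [lgm_le_iff hh, exp_lgm hk]
  exact integral_mono (hh.exp.integrable μ) (hk.exp.integrable μ)
    fun x => Real.exp_le_exp.2 (hle x)

/-- Jensen's inequality. -/
lemma integral_le_lgm (hh : BddMeas h) : ∫ x, h x ∂μ ≤ lgm μ h := by
  have h1 : ∫ x, (1 + (h x - ∫ y, h y ∂μ)) ∂μ ≤ ∫ x, Real.exp (h x - ∫ y, h y ∂μ) ∂μ :=
    integral_mono (((BddMeas.const 1).add (hh.sub (BddMeas.const _))).integrable μ)
      ((hh.sub (BddMeas.const _)).exp.integrable μ)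
      fun x => by simpa [add_comm] using Real.add_one_le_exp (h x - ∫ y, h y ∂μ)
  rw [integral_add (integrable_const _) ((hh.sub (BddMeas.const _)).integrable μ),
    integral_sub (hh.integrable μ) (integrable_const _), integral_exp_sub, ← exp_lgm hh,
    ← Real.exp_add] at h1
  have h2 : Real.exp 0 ≤ Real.exp (-∫ y, h y ∂μ + lgm μ h) := by simpa using h1
  linarith [Real.exp_le_exp.1 h2]

lemma lgm_nonneg (hh : BddMeas h) (h0 : ∀ x, 0 ≤ h x) : 0 ≤ lgm μ h :=
  (integral_nonneg h0).trans (integral_le_lgm hh)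

lemma lgm_add_const (hh : BddMeas h) (c : ℝ) : lgm μ (fun x => h x + c) = lgm μ h + c := by
  apply Real.exp_injective
  rw [exp_lgm (hh.add (BddMeas.const c)), Real.exp_add, exp_lgm hh, ← integral_mul_const]
  simp only [Real.exp_add]

/-- The log-Laplace transform is convex (at midpoints). -/
lemma lgm_midpoint_le (hh : BddMeas h) (hk : BddMeas k) :
    lgm μ (fun x => (1 / 2) * h x + (1 / 2) * k x) ≤ (1 / 2) * lgm μ h + (1 / 2) * lgm μ k := by
  have hm := (hh.const_mul (1 / 2)).add (hk.const_mul (1 / 2))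
  have hh' := hh.sub (BddMeas.const (lgm μ h))
  have hk' := hk.sub (BddMeas.const (lgm μ k))
  -- Once both exponentials are normalized to have mean 1, pointwise convexity of exp suffices.
  have key : ∫ x, Real.exp ((1 / 2) * h x + (1 / 2) * k x
      - ((1 / 2) * lgm μ h + (1 / 2) * lgm μ k)) ∂μ ≤
      ∫ x, ((1 / 2) * Real.exp (h x - lgm μ h) + (1 / 2) * Real.exp (k x - lgm μ k)) ∂μ := by
    refine integral_mono ((hm.sub (BddMeas.const _)).exp.integrable μ)
      (((hh'.exp.const_mul _).add (hk'.exp.const_mul _)).integrable μ) fun x => ?_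
    have := convexOn_exp.2 (Set.mem_univ (h x - lgm μ h)) (Set.mem_univ (k x - lgm μ k))
      (by norm_num : (0 : ℝ) ≤ 1 / 2) (by norm_num : (0 : ℝ) ≤ 1 / 2) (by norm_num)
    simp only [smul_eq_mul] at this
    refine le_trans (le_of_eq ?_) this
    congr 1; ring
  rw [integral_add ((hh'.exp.const_mul _).integrable μ) ((hk'.exp.const_mul _).integrable μ),
    integral_const_mul, integral_const_mul, integral_exp_sub_lgm hh, integral_exp_sub_lgm hk,
    integral_exp_sub, ← exp_lgm hm, ← Real.exp_add] at key
  have h2 := Real.exp_le_exp.1 (key.trans (le_of_eq (by norm_num : _ = Real.exp 0)))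
  linarith

/-- Bernoulli's inequality for powers of `exp (h - lgm μ h)`, which has mean 1. It serves to move a
numerical factor from outside the logarithm into the exponent. -/
lemma nat_mul_lgm_le (hh : BddMeas h) (m : ℕ) :
    m * lgm μ h ≤ lgm μ (fun x => m * h x) := by
  have hm := hh.const_mul (m : ℝ)
  have hh' := hh.sub (BddMeas.const (lgm μ h))
  have key : ∫ x, (1 + (m : ℝ) * (Real.exp (h x - lgm μ h) - 1)) ∂μ ≤
      ∫ x, Real.exp (m * h x - m * lgm μ h) ∂μ := by
    refine integral_mono
      (((BddMeas.const 1).add ((hh'.exp.sub (BddMeas.const 1)).const_mul _)).integrable μ)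
      ((hm.sub (BddMeas.const _)).exp.integrable μ) fun x => ?_
    have := one_add_mul_le_pow (a := Real.exp (h x - lgm μ h) - 1)
      (by linarith [Real.exp_pos (h x - lgm μ h)]) m
    simpa [← Real.exp_nat_mul, mul_sub] using this
  rw [integral_add (integrable_const _) (((hh'.exp.sub (BddMeas.const 1)).const_mul _).integrable μ),
    integral_const_mul, integral_sub (hh'.exp.integrable μ) (integrable_const _),
    integral_exp_sub_lgm hh, integral_exp_sub, ← exp_lgm hm, ← Real.exp_add] at key
  have h2 : Real.exp 0 ≤ Real.exp (-(m * lgm μ h) + lgm μ (fun x => m * h x)) := by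
    simpa using key
  linarith [Real.exp_le_exp.1 h2]

lemma isProbabilityMeasure_tilted' (hφ : BddMeas φ) : IsProbabilityMeasure (μ.tilted φ) :=
  isProbabilityMeasure_tilted (hφ.exp.integrable μ)

lemma lgm_tilted (hφ : BddMeas φ) (hh : BddMeas h) :
    lgm (μ.tilted φ) h = lgm μ (fun x => h x + φ x) - lgm μ φ := by
  have h1 := integral_exp_pos ((hh.add hφ).exp.integrable μ)
  have h2 := integral_exp_pos (hφ.exp.integrable μ)
  rw [lgm, integral_exp_tilted, lgm, lgm, ← Real.log_div h1.ne' h2.ne']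
  simp only [Pi.add_apply, add_comm]

/-- The Donsker-Varadhan inequality for a tilted measure. -/
lemma integral_tilted_le (hφ : BddMeas φ) (hh : BddMeas h) :
    ∫ x, h x ∂(μ.tilted φ) ≤ klTilt μ φ + lgm μ h := by
  have := isProbabilityMeasure_tilted' (μ := μ) hφ
  -- Jensen under the tilted measure for `h - φ`: subtracting `φ` undoes the tilt inside the
  -- log-Laplace transform.
  have h1 := integral_le_lgm (μ := μ.tilted φ) (hh.sub hφ)
  rw [lgm_tilted hφ (hh.sub hφ), integral_sub (hh.integrable _) (hφ.integrable _)] at h1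
  simp only [sub_add_cancel] at h1
  rw [klTilt]; linarith

lemma klTilt_nonneg (hφ : BddMeas φ) : 0 ≤ klTilt μ φ := by
  have := integral_tilted_le (μ := μ) hφ (BddMeas.const 0)
  simpa [lgm] using this

/-- The Donsker-Varadhan inequality with the roles of `μ` and `μ.tilted φ` exchanged. -/
lemma integral_le_lgm_tilted (hφ : BddMeas φ) (hh : BddMeas h) :
    ∫ x, h x ∂μ ≤ lgm μ φ - ∫ x, φ x ∂μ + lgm (μ.tilted φ) h := by
  have h1 := integral_le_lgm (μ := μ) (hh.add hφ)
  rw [integral_add (hh.integrable _) (hφ.integrable _)] at h1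
  rw [lgm_tilted hφ hh]; linarith

lemma klTilt_zero : klTilt μ (fun _ => 0) = 0 := by
  simp [klTilt, lgm]

lemma BddMeas.lgm {h : α → β → ℝ} (hh : BddMeas (fun p : α × β => h p.1 p.2)) :
    BddMeas (fun a => lgm ν (h a)) := by
  obtain ⟨C, hC⟩ := hh.bdd
  refine ⟨(hh.exp.integral ν).meas.log, C, fun a => ?_⟩
  have hlow : -C ≤ ∫ b, h a b ∂ν := by
    have h1 := integral_mono (μ := ν) (f := fun _ => -C) (g := h a) (integrable_const _)
      ((hh.right a).integrable ν) fun b => (abs_le.1 (hC (a, b))).1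
    simpa using h1
  have hup : GibbsSelection.lgm ν (h a) ≤ GibbsSelection.lgm ν (fun _ => C) :=
    lgm_mono (hh.right a) (BddMeas.const C) fun b => (abs_le.1 (hC (a, b))).2
  refine abs_le.2 ⟨hlow.trans (integral_le_lgm (hh.right a)), hup.trans ?_⟩
  simp [GibbsSelection.lgm]

/-- The iterated log-Laplace transform `log ∫∫ e^h dν dμ`. -/
noncomputable def lgm₂ (μ : Measure α) (ν : Measure β) (h : α → β → ℝ) : ℝ :=
  GibbsSelection.lgm μ fun a => GibbsSelection.lgm ν (h a)

omit [IsProbabilityMeasure μ] in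
lemma lgm₂_eq_log {h : α → β → ℝ} (hh : BddMeas (fun p : α × β => h p.1 p.2)) :
    lgm₂ μ ν h = Real.log (∫ a, ∫ b, Real.exp (h a b) ∂ν ∂μ) := by
  rw [lgm₂, GibbsSelection.lgm]
  simp only [exp_lgm (hh.right _)]

lemma lgm₂_le_iff {h : α → β → ℝ} (hh : BddMeas (fun p : α × β => h p.1 p.2)) {c : ℝ} :
    lgm₂ μ ν h ≤ c ↔ ∫ a, ∫ b, Real.exp (h a b) ∂ν ∂μ ≤ Real.exp c := by
  rw [lgm₂, lgm_le_iff (BddMeas.lgm hh)]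
  simp only [exp_lgm (hh.right _)]

lemma lgm₂_mono {h k : α → β → ℝ} (hh : BddMeas (fun p : α × β => h p.1 p.2))
    (hk : BddMeas (fun p : α × β => k p.1 p.2)) (hle : ∀ a b, h a b ≤ k a b) :
    lgm₂ μ ν h ≤ lgm₂ μ ν k :=
  lgm_mono (BddMeas.lgm hh) (BddMeas.lgm hk) fun a => lgm_mono (hh.right a) (hk.right a) (hle a)

lemma lgm₂_nonneg {h : α → β → ℝ} (hh : BddMeas (fun p : α × β => h p.1 p.2))
    (h0 : ∀ a b, 0 ≤ h a b) : 0 ≤ lgm₂ μ ν h :=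
  lgm_nonneg (BddMeas.lgm hh) fun a => lgm_nonneg (hh.right a) (h0 a)

lemma lgm₂_midpoint_le {h k : α → β → ℝ} (hh : BddMeas (fun p : α × β => h p.1 p.2))
    (hk : BddMeas (fun p : α × β => k p.1 p.2)) :
    lgm₂ μ ν (fun a b => (1 / 2) * h a b + (1 / 2) * k a b) ≤
      (1 / 2) * lgm₂ μ ν h + (1 / 2) * lgm₂ μ ν k :=
  (lgm_mono
    (BddMeas.lgm (h := fun a b => (1 / 2) * h a b + (1 / 2) * k a b)
      ((hh.const_mul _).add (hk.const_mul _)))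
    (((BddMeas.lgm hh).const_mul _).add ((BddMeas.lgm hk).const_mul _))
    fun a => lgm_midpoint_le (hh.right a) (hk.right a)).trans
  (lgm_midpoint_le (BddMeas.lgm hh) (BddMeas.lgm hk))

lemma nat_mul_lgm₂_le {h : α → β → ℝ} (hh : BddMeas (fun p : α × β => h p.1 p.2)) (m : ℕ) :
    m * lgm₂ μ ν h ≤ lgm₂ μ ν (fun a b => m * h a b) :=
  (nat_mul_lgm_le (BddMeas.lgm hh) m).trans <|
    lgm_mono ((BddMeas.lgm hh).const_mul _)
      (BddMeas.lgm (h := fun a b => (m : ℝ) * h a b) (hh.const_mul _))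
      fun a => nat_mul_lgm_le (hh.right a) m

lemma lgm_integral_le {h : α → β → ℝ} (hh : BddMeas (fun p : α × β => h p.1 p.2)) :
    GibbsSelection.lgm μ (fun a => ∫ b, h a b ∂ν) ≤ lgm₂ μ ν h :=
  lgm_mono (hh.integral ν) (BddMeas.lgm hh) fun a => integral_le_lgm (hh.right a)

/-- The Donsker-Varadhan inequality for a pair of tilted measures. -/
lemma integral_integral_tilted_le {h : α → β → ℝ} (hh : BddMeas (fun p : α × β => h p.1 p.2))
    {ψ : β → ℝ} (hφ : BddMeas φ) (hψ : BddMeas ψ) :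
    ∫ a, ∫ b, h a b ∂(ν.tilted ψ) ∂(μ.tilted φ) ≤ klTilt μ φ + klTilt ν ψ + lgm₂ μ ν h := by
  have := isProbabilityMeasure_tilted' (μ := μ) hφ
  have := isProbabilityMeasure_tilted' (μ := ν) hψ
  have h1 : ∫ a, ∫ b, h a b ∂(ν.tilted ψ) ∂(μ.tilted φ) ≤
      ∫ a, (klTilt ν ψ + GibbsSelection.lgm ν (h a)) ∂(μ.tilted φ) :=
    integral_mono ((hh.integral _).integrable _)
      (((BddMeas.const _).add (BddMeas.lgm hh)).integrable _)
      fun a => integral_tilted_le hψ (hh.right a)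
  rw [integral_add (integrable_const _) ((BddMeas.lgm hh).integrable _)] at h1
  have h2 := integral_tilted_le (μ := μ) hφ (BddMeas.lgm (ν := ν) hh)
  simp only [integral_const, probReal_univ, smul_eq_mul, one_mul] at h1
  rw [lgm₂]; linarith

end lgm

/-! ### Elementary inequalities -/

/-- The difference of the two sides vanishes at t = 0 and is monotone, since convexity of exp gives
e^{cx} - 1 ≤ c (e^x - 1). -/
lemma exp_mul_sub_le {c t : ℝ} (hc0 : 0 ≤ c) (hc1 : c ≤ 1) (ht : 0 ≤ t) :
    Real.exp (c * t) - 1 - c * t ≤ c ^ 2 * (Real.exp t - 1 - t) := by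
  have hd : ∀ x : ℝ, HasDerivAt
      (fun x => c ^ 2 * (Real.exp x - 1 - x) - (Real.exp (c * x) - 1 - c * x))
      (c ^ 2 * (Real.exp x - 1) - (Real.exp (c * x) * c - c)) x := by
    intro x
    have h1 : HasDerivAt (fun x : ℝ => c * x) c x := by
      simpa using (hasDerivAt_id x).const_mul c
    exact ((((Real.hasDerivAt_exp x).sub_const 1).sub (hasDerivAt_id x)).const_mul (c ^ 2)).sub
      ((h1.exp.sub_const 1).sub h1)
  have hmono : MonotoneOn
      (fun x => c ^ 2 * (Real.exp x - 1 - x) - (Real.exp (c * x) - 1 - c * x)) (Set.Ici 0) := by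
    refine monotoneOn_of_deriv_nonneg (convex_Ici 0)
      (fun x _ => (hd x).continuousAt.continuousWithinAt)
      (fun x _ => (hd x).differentiableAt.differentiableWithinAt) fun x hx => ?_
    rw [(hd x).deriv]
    have := convexOn_exp.2 (Set.mem_univ x) (Set.mem_univ 0) hc0 (sub_nonneg.2 hc1) (by ring)
    simp only [smul_eq_mul, mul_zero, add_zero, Real.exp_zero, mul_one] at this
    nlinarith
  have := hmono Set.self_mem_Ici ht ht
  simp at this
  linarith

/-- The pointwise form of Bernstein's inequality. Negative c reduces to |c| because x ≤ sinh x for x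
≥ 0. -/
lemma exp_mul_le_one_add_psi {c t : ℝ} (hc : |c| ≤ 1) (ht : 0 < t) :
    Real.exp (c * t) ≤ 1 + c * t + t ^ 2 * psi t * c ^ 2 := by
  have h1 : t ^ 2 * psi t = Real.exp t - 1 - t := by
    rw [psi, mul_div_cancel₀ _ (by positivity)]
  have h2 := exp_mul_sub_le (abs_nonneg c) hc ht.le
  rw [sq_abs] at h2
  rw [h1]
  rcases le_total 0 c with h | h
  · rw [abs_of_nonneg h] at h2; linarith
  · rw [abs_of_nonpos h] at h2
    have h3 : -c * t ≤ Real.sinh (-c * t) :=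
      Real.self_le_sinh_iff.2 (mul_nonneg (by linarith) ht.le)
    rw [Real.sinh_eq, neg_mul, neg_neg] at h3
    rw [neg_mul] at h2
    linarith

/-- Multiply by e^s ≥ 1 + s + s²/2 and use (1 - s + s²/2)(1 + s + s²/2) = 1 + s⁴/4. -/
lemma exp_neg_le_quadratic {s : ℝ} (hs : 0 ≤ s) : Real.exp (-s) ≤ 1 - s + s ^ 2 / 2 := by
  have h := Real.quadratic_le_exp_of_nonneg hs
  have h0 : (0 : ℝ) ≤ 1 - s + s ^ 2 / 2 := by nlinarith [sq_nonneg (s - 1)]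
  have h1 : Real.exp (-s) * Real.exp s = 1 := by rw [← Real.exp_add]; simp
  have h2 : 1 ≤ (1 - s + s ^ 2 / 2) * Real.exp s :=
    le_trans (by nlinarith [sq_nonneg (s ^ 2)]) (mul_le_mul_of_nonneg_left h h0)
  nlinarith [Real.exp_pos s]

lemma exp_mul_le_of_mem_unit (s : ℝ) {u : ℝ} (h0 : 0 ≤ u) (h1 : u ≤ 1) :
    Real.exp (s * u) ≤ 1 + (Real.exp s - 1) * u := by
  have := convexOn_exp.2 (Set.mem_univ s) (Set.mem_univ 0) h0 (sub_nonneg.2 h1) (by ring)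
  simp only [smul_eq_mul, mul_zero, add_zero, Real.exp_zero, mul_one] at this
  rw [mul_comm s]; linarith

lemma psi_nonneg (t : ℝ) : 0 ≤ psi t :=
  div_nonneg (by linarith [Real.add_one_le_exp t]) (sq_nonneg t)

/-- Taylor's formula gives Ψ(t) ≤ 1/2 + t/6 + t²/24 + t³/100. The range is dictated by the grid:
0.76 = 4 · 0.19 bounds the largest argument 4λ/n. -/
lemma psi_le {t : ℝ} (h0 : 0 < t) (h1 : t ≤ 0.76) : psi t ≤ 0.66 := by
  have h := Real.exp_bound' h0.le (by linarith) (n := 5) (by norm_num)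
  simp only [Finset.sum_range_succ, Finset.sum_range_zero, Nat.factorial] at h
  rw [psi, div_le_iff₀ (by positivity)]
  norm_num at h
  have h3 : t / 6 + t ^ 2 / 24 + t ^ 3 / 100 ≤ 0.16 := by
    have : t ^ 2 ≤ 0.76 ^ 2 := by gcongr
    have : t ^ 3 ≤ 0.76 ^ 3 := by gcongr
    norm_num at *; linarith
  nlinarith [mul_le_mul_of_nonneg_left h3 (sq_nonneg t)]

lemma psi_mul_le_one {t : ℝ} (h0 : 0 < t) (h1 : t ≤ 0.76) : psi t * (1 + t / 2) ≤ 1 := by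
  have h2 := psi_le h0 h1
  have h3 := psi_nonneg t
  calc psi t * (1 + t / 2) ≤ 0.66 * (1 + 0.76 / 2) := by gcongr
    _ ≤ 1 := by norm_num

lemma mul_psi_mul_le_one {t : ℝ} (h0 : 0 < t) (h1 : t ≤ 0.76) :
    t * psi t * (1 + t / 2) ^ 2 ≤ 1 := by
  have h2 := psi_le h0 h1
  have h3 := psi_nonneg t
  calc t * psi t * (1 + t / 2) ^ 2 ≤ 0.76 * 0.66 * (1 + 0.76 / 2) ^ 2 := by gcongr
    _ ≤ 1 := by norm_num

lemma exp_sub_one_le {s : ℝ} (h0 : 0 ≤ s) (h1 : s ≤ 1.2) : Real.exp s - 1 ≤ 4 * s := by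
  have h2 : Real.exp s ≤ 4 := by
    have h3 : Real.exp s ≤ Real.exp 1 * Real.exp 0.2 := by
      rw [← Real.exp_add]; exact Real.exp_le_exp.2 (by linarith)
    have h4 : Real.exp 0.2 ≤ 1 / (1 - 0.2) := Real.exp_bound_div_one_sub_of_interval
      (by norm_num) (by norm_num)
    nlinarith [Real.exp_one_lt_d9, Real.exp_pos 0.2, Real.exp_pos 1]
  have h5 : Real.exp s - 1 ≤ s * Real.exp s := by
    have := Real.add_one_le_exp (-s)
    have h6 : Real.exp (-s) * Real.exp s = 1 := by rw [← Real.exp_add]; simp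
    nlinarith [Real.exp_pos s]
  nlinarith

/-! ### Exponential moments of empirical means -/

section Moments

variable {Ω : Type*} [MeasurableSpace Ω] {P : Measure Ω} [IsProbabilityMeasure P]

/-- Common source of the three moment bounds: 𝔼 e^ξ ≤ 1 + 𝔼 η ≤ e^{𝔼 η}. -/
lemma integral_exp_sub_integral_le_one {ξ η : Ω → ℝ} (hξ : BddMeas ξ) (hη : BddMeas η)
    (h : ∀ p, Real.exp (ξ p) ≤ 1 + η p) : ∫ p, Real.exp (ξ p - ∫ p', η p' ∂P) ∂P ≤ 1 := by
  have h1 : ∫ p, Real.exp (ξ p) ∂P ≤ ∫ p, (1 + η p) ∂P :=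
    integral_mono (hξ.exp.integrable P) (((BddMeas.const 1).add hη).integrable P) h
  rw [integral_add (integrable_const _) (hη.integrable P)] at h1
  simp only [integral_const, probReal_univ, smul_eq_mul, one_mul] at h1
  rw [integral_exp_sub, ← Real.exp_zero]
  have h2 : ∫ p, Real.exp (ξ p) ∂P ≤ Real.exp (∫ p', η p' ∂P) := by
    linarith [Real.add_one_le_exp (∫ p', η p' ∂P)]
  calc _ ≤ Real.exp (-∫ p', η p' ∂P) * Real.exp (∫ p', η p' ∂P) := by gcongr
    _ = Real.exp 0 := by rw [← Real.exp_add]; simp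

lemma integral_exp_sum_le_one {θ : Ω → ℝ} (h : ∫ p, Real.exp (θ p) ∂P ≤ 1) (n : ℕ) :
    ∫ z : Fin n → Ω, Real.exp (∑ i, θ (z i)) ∂(Measure.pi fun _ => P) ≤ 1 := by
  simp only [Real.exp_sum]
  rw [integral_fintype_prod_eq_prod (fun _ p => Real.exp (θ p))]
  exact Finset.prod_le_one (fun _ _ => integral_nonneg fun _ => (Real.exp_pos _).le) fun _ _ => h

lemma integral_exp_bernstein_le_one {W : Ω → ℝ} (hW : BddMeas W) (h1 : ∀ p, |W p| ≤ 1)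
    {t : ℝ} (ht : 0 < t) :
    ∫ p, Real.exp (t * ((∫ p', W p' ∂P) - W p) - t ^ 2 * psi t * ∫ p', W p' ^ 2 ∂P) ∂P ≤ 1 := by
  have hW2 : BddMeas fun p => W p ^ 2 := by simpa [sq] using hW.mul hW
  have := integral_exp_sub_integral_le_one (P := P) (hW.const_mul (-t))
    ((hW.const_mul (-t)).add (hW2.const_mul (t ^ 2 * psi t))) fun p => by
      have := exp_mul_le_one_add_psi (c := -W p) (by simpa using h1 p) ht
      refine le_trans (le_of_eq ?_) (this.trans (le_of_eq ?_))
      · congr 1; ring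
      · ring
  rw [integral_add ((hW.const_mul _).integrable P) ((hW2.const_mul _).integrable P),
    integral_const_mul, integral_const_mul] at this
  refine le_trans (le_of_eq ?_) this
  congr 1 with p
  congr 1; ring

/-- As U² ≤ U, the quadratic bound on e^{-βU} becomes linear in U; this produces the factor 1 - β/2.
-/
lemma integral_exp_lower_le_one {U : Ω → ℝ} (hU : BddMeas U) (h0 : ∀ p, 0 ≤ U p)
    (h1 : ∀ p, U p ≤ 1) {β : ℝ} (hβ : 0 ≤ β) :
    ∫ p, Real.exp (β * ((1 - β / 2) * (∫ p', U p' ∂P) - U p)) ∂P ≤ 1 := by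
  have := integral_exp_sub_integral_le_one (P := P) (hU.const_mul (-β))
    (hU.const_mul (-(β * (1 - β / 2)))) fun p => by
      have := exp_neg_le_quadratic (mul_nonneg hβ (h0 p))
      rw [neg_mul]
      nlinarith [mul_nonneg (mul_nonneg (sq_nonneg β) (h0 p)) (sub_nonneg.2 (h1 p))]
  rw [integral_const_mul] at this
  refine le_trans (le_of_eq ?_) this
  congr 1 with p
  congr 1; ring

lemma integral_exp_upper_le_one {U : Ω → ℝ} (hU : BddMeas U) (h0 : ∀ p, 0 ≤ U p)
    (h1 : ∀ p, U p ≤ 1) (s : ℝ) :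
    ∫ p, Real.exp (s * U p - (Real.exp s - 1) * (∫ p', U p' ∂P)) ∂P ≤ 1 := by
  have := integral_exp_sub_integral_le_one (P := P) (hU.const_mul s)
    (hU.const_mul (Real.exp s - 1)) fun p => exp_mul_le_of_mem_unit s (h0 p) (h1 p)
  rwa [integral_const_mul] at this

end Moments

/-! ### Deviation events -/

/-- Markov's inequality for an exponential moment integrated with respect to a pair of priors. -/
lemma measure_compl_exp_integral_le {Z G : Type*} [MeasurableSpace Z] [MeasurableSpace G]
    {ℙ : Measure Z} [IsProbabilityMeasure ℙ] {μ ν : Measure G} [IsProbabilityMeasure μ]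
    [IsProbabilityMeasure ν] {F : Z → G → G → ℝ}
    (hF : BddMeas fun p : (Z × G) × G => F p.1.1 p.1.2 p.2)
    (h1 : ∀ g₁ g₂, ∫ z, Real.exp (F z g₁ g₂) ∂ℙ ≤ 1) (c : ℝ) :
    MeasurableSet {z | ∫ g₁, ∫ g₂, Real.exp (F z g₁ g₂) ∂ν ∂μ ≤ Real.exp c} ∧
      ℙ.real {z | ∫ g₁, ∫ g₂, Real.exp (F z g₁ g₂) ∂ν ∂μ ≤ Real.exp c}ᶜ ≤ Real.exp (-c) := by
  have hI : BddMeas fun p : Z × G => ∫ g₂, Real.exp (F p.1 p.2 g₂) ∂ν :=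
    BddMeas.integral (h := fun (p : Z × G) g₂ => Real.exp (F p.1 p.2 g₂)) hF.exp ν
  have hJ : BddMeas fun z => ∫ g₁, ∫ g₂, Real.exp (F z g₁ g₂) ∂ν ∂μ :=
    BddMeas.integral (h := fun z g₁ => ∫ g₂, Real.exp (F z g₁ g₂) ∂ν) hI μ
  refine ⟨measurableSet_le hJ.meas measurable_const, ?_⟩
  have hpos : ∀ z, 0 ≤ ∫ g₁, ∫ g₂, Real.exp (F z g₁ g₂) ∂ν ∂μ := fun z =>
    integral_nonneg fun _ => integral_nonneg fun _ => (Real.exp_pos _).le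
  have hswap : ∫ z, ∫ g₁, ∫ g₂, Real.exp (F z g₁ g₂) ∂ν ∂μ ∂ℙ ≤ 1 := by
    rw [integral_integral_swap (f := fun z g₁ => ∫ g₂, Real.exp (F z g₁ g₂) ∂ν)
      (hI.integrable (ℙ.prod μ))]
    have hI2 : BddMeas fun p : G × G => ∫ z, Real.exp (F z p.1 p.2) ∂ℙ :=
      BddMeas.integral (h := fun (p : G × G) z => Real.exp (F z p.1 p.2))
        (hF.exp.comp (φ := fun q : (G × G) × Z => ((q.2, q.1.1), q.1.2)) (by fun_prop)) ℙ
    have h2 : ∀ g₁, ∫ z, ∫ g₂, Real.exp (F z g₁ g₂) ∂ν ∂ℙ ≤ 1 := fun g₁ => by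
      have h3 : BddMeas fun p : Z × G => Real.exp (F p.1 g₁ p.2) :=
        hF.exp.comp (φ := fun q : Z × G => ((q.1, g₁), q.2)) (by fun_prop)
      rw [integral_integral_swap (f := fun z g₂ => Real.exp (F z g₁ g₂))
        (h3.integrable (ℙ.prod ν))]
      have := integral_mono (μ := ν)
        ((BddMeas.right (h := fun g₁ g₂ => ∫ z, Real.exp (F z g₁ g₂) ∂ℙ) hI2 g₁).integrable ν)
        (integrable_const 1) (h1 g₁)
      simpa using this
    have := integral_mono (μ := μ)
      ((BddMeas.integral (h := fun g₁ z => ∫ g₂, Real.exp (F z g₁ g₂) ∂ν)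
        (hI.comp (φ := fun q : G × Z => (q.2, q.1)) (by fun_prop)) ℙ).integrable μ)
      (integrable_const 1) h2
    simpa using this
  have hM := mul_meas_ge_le_integral_of_nonneg (ae_of_all _ hpos) (hJ.integrable ℙ) (Real.exp c)
  have hsub : ℙ.real {z | ∫ g₁, ∫ g₂, Real.exp (F z g₁ g₂) ∂ν ∂μ ≤ Real.exp c}ᶜ ≤
      ℙ.real {z | Real.exp c ≤ ∫ g₁, ∫ g₂, Real.exp (F z g₁ g₂) ∂ν ∂μ} :=
    measureReal_mono fun z hz => (not_le.1 (Set.notMem_ofPred_iff.1 hz)).le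
  refine hsub.trans ?_
  rw [Real.exp_neg, ← one_div, le_div_iff₀ (Real.exp_pos c), mul_comm]
  exact hM.trans hswap

/-! ### The empirical process -/

section Sample

variable {X Y G : Type*} [MeasurableSpace X] [MeasurableSpace Y] [MeasurableSpace G]

/-- The quadratic distance `𝔼_{(X,Y) ∼ P} [l(Y, g₁(X)) - l(Y, g₂(X))]²`. -/
noncomputable def sqDist (P : Measure (X × Y)) (l : Y → Y → ℝ) (f : G → X → Y) (g₁ g₂ : G) : ℝ :=
  ∫ p, (l p.2 (f g₁ p.1) - l p.2 (f g₂ p.1)) ^ 2 ∂P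

variable {P : Measure (X × Y)} [IsProbabilityMeasure P] {l : Y → Y → ℝ} {f : G → X → Y}
  {n : ℕ}

lemma BddMeas.loss (hf : Measurable (fun q : G × X => f q.1 q.2))
    (hl : Measurable (fun q : Y × Y => l q.1 q.2)) (hl01 : ∀ y y', 0 ≤ l y y' ∧ l y y' ≤ 1) :
    BddMeas fun q : G × (X × Y) => l q.2.2 (f q.1 q.2.1) := by
  refine ⟨?_, 1, fun q => abs_le.2 ⟨by linarith [(hl01 q.2.2 (f q.1 q.2.1)).1], (hl01 _ _).2⟩⟩
  have h1 : Measurable fun q : G × (X × Y) => f q.1 q.2.1 :=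
    hf.comp (g := fun q : G × X => f q.1 q.2) (f := fun q : G × (X × Y) => (q.1, q.2.1))
      (by fun_prop)
  exact hl.comp (f := fun q : G × (X × Y) => (q.2.2, f q.1 q.2.1))
    ((by fun_prop : Measurable fun q : G × (X × Y) => q.2.2).prodMk h1)

lemma BddMeas.lossDiff (hq : BddMeas fun q : G × (X × Y) => l q.2.2 (f q.1 q.2.1)) :
    BddMeas fun q : (G × G) × (X × Y) =>
      l q.2.2 (f q.1.1 q.2.1) - l q.2.2 (f q.1.2 q.2.1) :=
  (hq.comp (φ := fun q : (G × G) × (X × Y) => (q.1.1, q.2)) (by fun_prop)).sub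
    (hq.comp (φ := fun q : (G × G) × (X × Y) => (q.1.2, q.2)) (by fun_prop))

lemma BddMeas.lossDiffSq (hq : BddMeas fun q : G × (X × Y) => l q.2.2 (f q.1 q.2.1)) :
    BddMeas fun q : (G × G) × (X × Y) =>
      (l q.2.2 (f q.1.1 q.2.1) - l q.2.2 (f q.1.2 q.2.1)) ^ 2 := by
  simpa only [sq] using (BddMeas.lossDiff hq).mul (BddMeas.lossDiff hq)

lemma BddMeas.risk (hq : BddMeas fun q : G × (X × Y) => l q.2.2 (f q.1 q.2.1)) :
    BddMeas (risk P l f) :=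
  BddMeas.integral (h := fun g (p : X × Y) => l p.2 (f g p.1)) hq P

lemma BddMeas.sqDist (hq : BddMeas fun q : G × (X × Y) => l q.2.2 (f q.1 q.2.1)) :
    BddMeas fun p : G × G => sqDist P l f p.1 p.2 :=
  BddMeas.integral (h := fun (g : G × G) (p : X × Y) =>
    (l p.2 (f g.1 p.1) - l p.2 (f g.2 p.1)) ^ 2) (BddMeas.lossDiffSq hq) P

lemma BddMeas.empRisk_uncurry (hq : BddMeas fun q : G × (X × Y) => l q.2.2 (f q.1 q.2.1)) :
    BddMeas fun p : (Fin n → X × Y) × G => empRisk l f p.1 p.2 :=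
  (BddMeas.sum Finset.univ fun i => hq.comp
    (φ := fun p : (Fin n → X × Y) × G => (p.2, p.1 i)) (by fun_prop)).const_mul _

lemma BddMeas.empSqDist_uncurry (hq : BddMeas fun q : G × (X × Y) => l q.2.2 (f q.1 q.2.1)) :
    BddMeas fun p : (Fin n → X × Y) × (G × G) => empSqDist l f p.1 p.2.1 p.2.2 :=
  (BddMeas.sum Finset.univ fun i => (BddMeas.lossDiffSq hq).comp
    (φ := fun p : (Fin n → X × Y) × (G × G) => (p.2, p.1 i)) (by fun_prop)).const_mul _

lemma BddMeas.empRisk (hq : BddMeas fun q : G × (X × Y) => l q.2.2 (f q.1 q.2.1))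
    (z : Fin n → X × Y) : BddMeas (empRisk l f z) :=
  (BddMeas.empRisk_uncurry hq).comp (φ := fun g : G => (z, g)) (by fun_prop)

lemma BddMeas.empSqDist (hq : BddMeas fun q : G × (X × Y) => l q.2.2 (f q.1 q.2.1))
    (z : Fin n → X × Y) : BddMeas fun p : G × G => empSqDist l f z p.1 p.2 :=
  (BddMeas.empSqDist_uncurry hq).comp (φ := fun g : G × G => (z, g)) (by fun_prop)

omit [MeasurableSpace X] [MeasurableSpace Y] [MeasurableSpace G] in
lemma empSqDist_nonneg (z : Fin n → X × Y) (g₁ g₂ : G) : 0 ≤ empSqDist l f z g₁ g₂ :=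
  mul_nonneg (by positivity) (Finset.sum_nonneg fun _ _ => sq_nonneg _)

omit [MeasurableSpace X] [MeasurableSpace Y] [MeasurableSpace G] in
lemma empSqDist_comm (z : Fin n → X × Y) (g₁ g₂ : G) :
    empSqDist l f z g₁ g₂ = empSqDist l f z g₂ g₁ := by
  simp only [empSqDist]
  congr 2 with i
  ring

omit [MeasurableSpace X] [MeasurableSpace Y] [MeasurableSpace G] in
lemma empSqDist_triangle (z : Fin n → X × Y) (g₁ g₂ g₃ : G) :
    empSqDist l f z g₁ g₃ ≤ 2 * empSqDist l f z g₁ g₂ + 2 * empSqDist l f z g₂ g₃ := by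
  simp only [empSqDist]
  rw [mul_left_comm, mul_left_comm 2, ← mul_add]
  refine mul_le_mul_of_nonneg_left ?_ (by positivity)
  rw [Finset.mul_sum, Finset.mul_sum, ← Finset.sum_add_distrib]
  refine Finset.sum_le_sum fun i _ => ?_
  nlinarith [sq_nonneg ((l (z i).2 (f g₁ (z i).1) - l (z i).2 (f g₂ (z i).1)) -
    (l (z i).2 (f g₂ (z i).1) - l (z i).2 (f g₃ (z i).1)))]

omit [MeasurableSpace G] [IsProbabilityMeasure P] in
lemma sqDist_nonneg (g₁ g₂ : G) : 0 ≤ sqDist P l f g₁ g₂ :=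
  integral_nonneg fun _ => sq_nonneg _

omit [MeasurableSpace X] [MeasurableSpace Y] [MeasurableSpace G] in
lemma natCast_mul_empSqDist (hn : 1 ≤ n) (z : Fin n → X × Y) (g₁ g₂ : G) :
    (n : ℝ) * empSqDist l f z g₁ g₂ =
      ∑ i, (l (z i).2 (f g₁ (z i).1) - l (z i).2 (f g₂ (z i).1)) ^ 2 := by
  have : (n : ℝ) ≠ 0 := by positivity
  rw [empSqDist]; field_simp

/-- The exponent of the Bernstein-type deviation inequality for the relative risk. -/
noncomputable def bernsteinExponent (P : Measure (X × Y)) (l : Y → Y → ℝ) (f : G → X → Y) (t : ℝ)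
    (z : Fin n → X × Y) (g₁ g₂ : G) : ℝ :=
  n * t * ((risk P l f g₁ - empRisk l f z g₁) - (risk P l f g₂ - empRisk l f z g₂))
    - n * t ^ 2 * psi t * sqDist P l f g₁ g₂

/-- The exponent of the lower deviation inequality for the empirical quadratic distance. -/
noncomputable def lowerExponent (P : Measure (X × Y)) (l : Y → Y → ℝ) (f : G → X → Y) (β : ℝ)
    (z : Fin n → X × Y) (g₁ g₂ : G) : ℝ :=
  n * β * ((1 - β / 2) * sqDist P l f g₁ g₂ - empSqDist l f z g₁ g₂)

/-- The exponent of the upper deviation inequality for the empirical quadratic distance. -/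
noncomputable def upperExponent (P : Measure (X × Y)) (l : Y → Y → ℝ) (f : G → X → Y) (s : ℝ)
    (z : Fin n → X × Y) (g₁ g₂ : G) : ℝ :=
  n * (s * empSqDist l f z g₁ g₂ - (Real.exp s - 1) * sqDist P l f g₁ g₂)

lemma integral_exp_bernsteinExponent_le (hn : 1 ≤ n)
    (hq : BddMeas fun q : G × (X × Y) => l q.2.2 (f q.1 q.2.1))
    (hl01 : ∀ y y', 0 ≤ l y y' ∧ l y y' ≤ 1) {t : ℝ} (ht : 0 < t) (g₁ g₂ : G) :
    ∫ z : Fin n → X × Y, Real.exp (bernsteinExponent P l f t z g₁ g₂)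
      ∂(Measure.pi fun _ => P) ≤ 1 := by
  have hW : BddMeas fun p : X × Y => l p.2 (f g₁ p.1) - l p.2 (f g₂ p.1) :=
    (BddMeas.lossDiff hq).comp (φ := fun p : X × Y => ((g₁, g₂), p)) (by fun_prop)
  have h1 := integral_exp_sum_le_one (integral_exp_bernstein_le_one (P := P) hW
    (fun p => abs_le.2 ⟨by linarith [(hl01 p.2 (f g₁ p.1)).1, (hl01 p.2 (f g₂ p.1)).2],
      by linarith [(hl01 p.2 (f g₁ p.1)).2, (hl01 p.2 (f g₂ p.1)).1]⟩) ht) n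
  refine le_trans (le_of_eq ?_) h1
  congr 1 with z
  have hn0 : (n : ℝ) ≠ 0 := by positivity
  rw [integral_sub ((BddMeas.right (h := fun g (p : X × Y) => l p.2 (f g p.1)) hq g₁).integrable P)
    ((BddMeas.right (h := fun g (p : X × Y) => l p.2 (f g p.1)) hq g₂).integrable P)]
  simp only [bernsteinExponent, empRisk, Finset.sum_sub_distrib, ← Finset.mul_sum,
    Finset.sum_const, Finset.card_univ, Fintype.card_fin, nsmul_eq_mul, risk, sqDist]
  congr 1
  field_simp
  ring

lemma integral_exp_lowerExponent_le (hn : 1 ≤ n)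
    (hq : BddMeas fun q : G × (X × Y) => l q.2.2 (f q.1 q.2.1))
    (hl01 : ∀ y y', 0 ≤ l y y' ∧ l y y' ≤ 1) {β : ℝ} (hβ : 0 ≤ β) (g₁ g₂ : G) :
    ∫ z : Fin n → X × Y, Real.exp (lowerExponent P l f β z g₁ g₂)
      ∂(Measure.pi fun _ => P) ≤ 1 := by
  have hU : BddMeas fun p : X × Y => (l p.2 (f g₁ p.1) - l p.2 (f g₂ p.1)) ^ 2 :=
    (BddMeas.lossDiffSq hq).comp (φ := fun p : X × Y => ((g₁, g₂), p)) (by fun_prop)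
  have h1 := integral_exp_sum_le_one (integral_exp_lower_le_one (P := P) hU
    (fun _ => sq_nonneg _) (fun p => (sq_le_one_iff_abs_le_one _).2
      (abs_le.2 ⟨by linarith [(hl01 p.2 (f g₁ p.1)).1, (hl01 p.2 (f g₂ p.1)).2],
      by linarith [(hl01 p.2 (f g₁ p.1)).2, (hl01 p.2 (f g₂ p.1)).1]⟩)) hβ) n
  refine le_trans (le_of_eq ?_) h1
  congr 1 with z
  have h2 := natCast_mul_empSqDist (l := l) (f := f) hn z g₁ g₂
  simp only [lowerExponent, Finset.sum_sub_distrib, ← Finset.mul_sum,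
    Finset.sum_const, Finset.card_univ, Fintype.card_fin, nsmul_eq_mul, ← h2]
  congr 1
  rw [sqDist]
  ring

lemma integral_exp_upperExponent_le (hn : 1 ≤ n)
    (hq : BddMeas fun q : G × (X × Y) => l q.2.2 (f q.1 q.2.1))
    (hl01 : ∀ y y', 0 ≤ l y y' ∧ l y y' ≤ 1) (s : ℝ) (g₁ g₂ : G) :
    ∫ z : Fin n → X × Y, Real.exp (upperExponent P l f s z g₁ g₂)
      ∂(Measure.pi fun _ => P) ≤ 1 := by
  have hU : BddMeas fun p : X × Y => (l p.2 (f g₁ p.1) - l p.2 (f g₂ p.1)) ^ 2 :=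
    (BddMeas.lossDiffSq hq).comp (φ := fun p : X × Y => ((g₁, g₂), p)) (by fun_prop)
  have h1 := integral_exp_sum_le_one (integral_exp_upper_le_one (P := P) hU
    (fun _ => sq_nonneg _) (fun p => (sq_le_one_iff_abs_le_one _).2
      (abs_le.2 ⟨by linarith [(hl01 p.2 (f g₁ p.1)).1, (hl01 p.2 (f g₂ p.1)).2],
      by linarith [(hl01 p.2 (f g₁ p.1)).2, (hl01 p.2 (f g₂ p.1)).1]⟩)) s) n
  refine le_trans (le_of_eq ?_) h1
  congr 1 with z
  have h2 := natCast_mul_empSqDist (l := l) (f := f) hn z g₁ g₂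
  simp only [upperExponent, Finset.sum_sub_distrib, ← Finset.mul_sum,
    Finset.sum_const, Finset.card_univ, Fintype.card_fin, nsmul_eq_mul, ← h2]
  congr 1
  rw [sqDist]
  ring

/-- The deviation inequalities for the sample `z` with respect to the priors `μ`, `ν`, at
confidence level `e^{-c}`. -/
structure Deviation (P : Measure (X × Y)) (l : Y → Y → ℝ) (f : G → X → Y) (μ ν : Measure G)
    (t β s c : ℝ) (z : Fin n → X × Y) : Prop where
  bernstein : ∫ g₁, ∫ g₂, Real.exp (bernsteinExponent P l f t z g₁ g₂) ∂ν ∂μ ≤ Real.exp c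
  lower : ∫ g₁, ∫ g₂, Real.exp (lowerExponent P l f β z g₁ g₂) ∂ν ∂μ ≤ Real.exp c
  upper : ∫ g₁, ∫ g₂, Real.exp (upperExponent P l f s z g₁ g₂) ∂ν ∂μ ≤ Real.exp c

lemma measure_compl_deviation_le (hn : 1 ≤ n)
    (hq : BddMeas fun q : G × (X × Y) => l q.2.2 (f q.1 q.2.1))
    (hl01 : ∀ y y', 0 ≤ l y y' ∧ l y y' ≤ 1) (μ ν : Measure G) [IsProbabilityMeasure μ]
    [IsProbabilityMeasure ν] {t β : ℝ} (ht : 0 < t) (hβ : 0 ≤ β) (s c : ℝ) :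
    MeasurableSet {z : Fin n → X × Y | Deviation P l f μ ν t β s c z} ∧
      (Measure.pi fun _ => P).real {z : Fin n → X × Y | Deviation P l f μ ν t β s c z}ᶜ ≤
        3 * Real.exp (-c) := by
  have hR : BddMeas (GibbsSelection.risk P l f) := BddMeas.risk hq
  have hr := BddMeas.empRisk_uncurry (n := n) hq
  have hV : BddMeas fun p : ((Fin n → X × Y) × G) × G =>
      GibbsSelection.empSqDist l f p.1.1 p.1.2 p.2 :=
    (BddMeas.empSqDist_uncurry hq).comp
      (φ := fun p : ((Fin n → X × Y) × G) × G => (p.1.1, (p.1.2, p.2))) (by fun_prop)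
  have hQ : BddMeas fun p : ((Fin n → X × Y) × G) × G => GibbsSelection.sqDist P l f p.1.2 p.2 :=
    (BddMeas.sqDist hq).comp
      (φ := fun p : ((Fin n → X × Y) × G) × G => (p.1.2, p.2)) (by fun_prop)
  have hB : BddMeas fun p : ((Fin n → X × Y) × G) × G =>
      bernsteinExponent P l f t p.1.1 p.1.2 p.2 :=
    ((((hR.comp (φ := fun p : ((Fin n → X × Y) × G) × G => p.1.2) (by fun_prop)).sub
      (hr.comp (φ := fun p : ((Fin n → X × Y) × G) × G => p.1) (by fun_prop))).sub
      ((hR.comp (φ := fun p : ((Fin n → X × Y) × G) × G => p.2) (by fun_prop)).sub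
      (hr.comp (φ := fun p : ((Fin n → X × Y) × G) × G => (p.1.1, p.2)) (by fun_prop)))).const_mul
      _).sub (hQ.const_mul _)
  obtain ⟨m1, p1⟩ := measure_compl_exp_integral_le (ℙ := Measure.pi fun _ : Fin n => P) (μ := μ)
    (ν := ν) (F := bernsteinExponent P l f t) hB
    (integral_exp_bernsteinExponent_le hn hq hl01 ht) c
  obtain ⟨m2, p2⟩ := measure_compl_exp_integral_le (ℙ := Measure.pi fun _ : Fin n => P) (μ := μ)
    (ν := ν) (F := lowerExponent P l f β) (((hQ.const_mul _).sub hV).const_mul _)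
    (integral_exp_lowerExponent_le hn hq hl01 hβ) c
  obtain ⟨m3, p3⟩ := measure_compl_exp_integral_le (ℙ := Measure.pi fun _ : Fin n => P) (μ := μ)
    (ν := ν) (F := upperExponent P l f s) (((hV.const_mul _).sub (hQ.const_mul _)).const_mul _)
    (integral_exp_upperExponent_le hn hq hl01 s) c
  have heq : {z : Fin n → X × Y | Deviation P l f μ ν t β s c z} =
      ({z | ∫ g₁, ∫ g₂, Real.exp (bernsteinExponent P l f t z g₁ g₂) ∂ν ∂μ ≤ Real.exp c} ∩
      {z | ∫ g₁, ∫ g₂, Real.exp (lowerExponent P l f β z g₁ g₂) ∂ν ∂μ ≤ Real.exp c}) ∩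
      {z | ∫ g₁, ∫ g₂, Real.exp (upperExponent P l f s z g₁ g₂) ∂ν ∂μ ≤ Real.exp c} :=
    Set.ext fun z => ⟨fun h => ⟨⟨h.1, h.2⟩, h.3⟩, fun h => ⟨h.1.1, h.1.2, h.2⟩⟩
  rw [heq]
  refine ⟨(m1.inter m2).inter m3, ?_⟩
  rw [Set.compl_inter, Set.compl_inter]
  refine (measureReal_union_le _ _).trans ?_
  linarith [measureReal_union_le (μ := Measure.pi fun _ : Fin n => P)
    {z | ∫ g₁, ∫ g₂, Real.exp (bernsteinExponent P l f t z g₁ g₂) ∂ν ∂μ ≤ Real.exp c}ᶜ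
    {z | ∫ g₁, ∫ g₂, Real.exp (lowerExponent P l f β z g₁ g₂) ∂ν ∂μ ≤ Real.exp c}ᶜ]

end Sample

/-! ### Consequences of the deviation inequalities -/

section Consequences

variable {X Y G : Type*} [MeasurableSpace X] [MeasurableSpace Y] [MeasurableSpace G]

/-- The difference between the risk and the empirical risk. -/
noncomputable def riskGap (P : Measure (X × Y)) (l : Y → Y → ℝ) (f : G → X → Y) {n : ℕ}
    (z : Fin n → X × Y) (g : G) : ℝ :=
  risk P l f g - empRisk l f z g

variable {P : Measure (X × Y)} [IsProbabilityMeasure P] {l : Y → Y → ℝ} {f : G → X → Y}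
  {n : ℕ} {z : Fin n → X × Y} {μ ν : Measure G} [IsProbabilityMeasure μ] [IsProbabilityMeasure ν]
  {t β s c : ℝ}

lemma BddMeas.riskGap (hq : BddMeas fun q : G × (X × Y) => l q.2.2 (f q.1 q.2.1)) :
    BddMeas (riskGap P l f z) :=
  (BddMeas.risk hq).sub (BddMeas.empRisk hq z)

lemma BddMeas.bernsteinExponent (hq : BddMeas fun q : G × (X × Y) => l q.2.2 (f q.1 q.2.1)) :
    BddMeas fun p : G × G => bernsteinExponent P l f t z p.1 p.2 := by
  have hd := BddMeas.riskGap (P := P) (z := z) hq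
  exact (((hd.comp (φ := fun p : G × G => p.1) (by fun_prop)).sub
    (hd.comp (φ := fun p : G × G => p.2) (by fun_prop))).const_mul _).sub
    ((BddMeas.sqDist hq).const_mul _)

lemma BddMeas.lowerExponent (hq : BddMeas fun q : G × (X × Y) => l q.2.2 (f q.1 q.2.1)) :
    BddMeas fun p : G × G => lowerExponent P l f β z p.1 p.2 :=
  (((BddMeas.sqDist hq).const_mul _).sub (BddMeas.empSqDist hq z)).const_mul _

lemma BddMeas.upperExponent (hq : BddMeas fun q : G × (X × Y) => l q.2.2 (f q.1 q.2.1)) :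
    BddMeas fun p : G × G => upperExponent P l f s z p.1 p.2 :=
  (((BddMeas.empSqDist hq z).const_mul _).sub ((BddMeas.sqDist hq).const_mul _)).const_mul _

lemma integral_bernsteinExponent (hq : BddMeas fun q : G × (X × Y) => l q.2.2 (f q.1 q.2.1))
    (g : G) :
    ∫ g', bernsteinExponent P l f t z g g' ∂ν =
      n * t * (riskGap P l f z g - ∫ g', riskGap P l f z g' ∂ν)
        - n * t ^ 2 * psi t * ∫ g', sqDist P l f g g' ∂ν := by
  have hd := BddMeas.riskGap (P := P) (z := z) hq
  have hQ := BddMeas.right (h := sqDist P l f) (BddMeas.sqDist hq) g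
  rw [← integral_const_mul (n * t ^ 2 * psi t)]
  have h1 : riskGap P l f z g - ∫ g', riskGap P l f z g' ∂ν =
      ∫ g', (riskGap P l f z g - riskGap P l f z g') ∂ν := by
    rw [integral_sub (integrable_const _) (hd.integrable ν)]; simp
  rw [h1, ← integral_const_mul, ← integral_sub
    ((((BddMeas.const _).sub hd).const_mul _).integrable ν) ((hQ.const_mul _).integrable ν)]
  rfl

lemma integral_integral_bernsteinExponent
    (hq : BddMeas fun q : G × (X × Y) => l q.2.2 (f q.1 q.2.1)) :
    ∫ g, ∫ g', bernsteinExponent P l f t z g g' ∂ν ∂μ =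
      n * t * (∫ g, riskGap P l f z g ∂μ - ∫ g, riskGap P l f z g ∂ν)
        - n * t ^ 2 * psi t * ∫ g, ∫ g', sqDist P l f g g' ∂ν ∂μ := by
  have hd := BddMeas.riskGap (P := P) (z := z) hq
  have hQ := BddMeas.integral (h := sqDist P l f) (BddMeas.sqDist hq) ν
  simp only [integral_bernsteinExponent hq]
  rw [integral_sub (((hd.sub (BddMeas.const _)).const_mul _).integrable μ)
    ((hQ.const_mul _).integrable μ), integral_const_mul, integral_const_mul,
    integral_sub (hd.integrable μ) (integrable_const _)]
  simp

lemma integral_integral_lowerExponent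
    (hq : BddMeas fun q : G × (X × Y) => l q.2.2 (f q.1 q.2.1)) :
    ∫ g, ∫ g', lowerExponent P l f β z g g' ∂ν ∂μ =
      n * β * ((1 - β / 2) * (∫ g, ∫ g', sqDist P l f g g' ∂ν ∂μ)
        - ∫ g, ∫ g', empSqDist l f z g g' ∂ν ∂μ) := by
  have hQ := BddMeas.sqDist (P := P) hq
  have hV := BddMeas.empSqDist hq z
  simp only [lowerExponent, integral_const_mul]
  have h1 : ∀ g, ∫ g', ((1 - β / 2) * sqDist P l f g g' - empSqDist l f z g g') ∂ν =
      (1 - β / 2) * (∫ g', sqDist P l f g g' ∂ν) - ∫ g', empSqDist l f z g g' ∂ν := fun g => by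
    rw [integral_sub (((BddMeas.right (h := sqDist P l f) hQ g).const_mul _).integrable ν)
      ((BddMeas.right (h := empSqDist l f z) hV g).integrable ν), integral_const_mul]
  simp only [h1]
  rw [integral_sub (((BddMeas.integral (h := sqDist P l f) hQ ν).const_mul _).integrable μ)
    ((BddMeas.integral (h := empSqDist l f z) hV ν).integrable μ), integral_const_mul]

omit [IsProbabilityMeasure P] in
lemma integral_integral_empSqDist_comm
    (hq : BddMeas fun q : G × (X × Y) => l q.2.2 (f q.1 q.2.1)) :
    ∫ g, ∫ g', empSqDist l f z g g' ∂ν ∂μ = ∫ g, ∫ g', empSqDist l f z g g' ∂μ ∂ν := by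
  rw [integral_integral_swap (f := empSqDist l f z) ((BddMeas.empSqDist hq z).integrable _)]
  simp only [fun g g' => empSqDist_comm (l := l) (f := f) z g g']

lemma Deviation.bernstein_tilted (h : Deviation P l f μ ν t β s c z)
    (hq : BddMeas fun q : G × (X × Y) => l q.2.2 (f q.1 q.2.1)) {φ ψ : G → ℝ}
    (hφ : BddMeas φ) (hψ : BddMeas ψ) :
    n * t * (∫ g, riskGap P l f z g ∂(μ.tilted φ) - ∫ g, riskGap P l f z g ∂(ν.tilted ψ)) ≤
      n * t ^ 2 * psi t * (∫ g, ∫ g', sqDist P l f g g' ∂(ν.tilted ψ) ∂(μ.tilted φ))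
        + (klTilt μ φ + klTilt ν ψ + c) := by
  have := isProbabilityMeasure_tilted' (μ := μ) hφ
  have := isProbabilityMeasure_tilted' (μ := ν) hψ
  have hB := BddMeas.bernsteinExponent (P := P) (t := t) (z := z) hq
  have h1 := integral_integral_tilted_le (μ := μ) (ν := ν)
    (h := bernsteinExponent P l f t z) hB hφ hψ
  rw [integral_integral_bernsteinExponent hq] at h1
  have h2 := (lgm₂_le_iff (μ := μ) (ν := ν) (h := bernsteinExponent P l f t z) hB).2 h.bernstein
  linarith

/-- Replaces the population quadratic distance in Bernstein's bound by the empirical one. With β =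
t/(1 + t/2) one has 1 - β/2 = 1/(1 + t/2), so adding tΨ(t)(1 + t/2)² times the lower deviation bound
cancels the population term exactly. The coefficients `coefA` and `coefB` come from here. -/
lemma Deviation.empirical_tilted (h : Deviation P l f μ ν t (t / (1 + t / 2)) s c z) (ht : 0 < t)
    (hq : BddMeas fun q : G × (X × Y) => l q.2.2 (f q.1 q.2.1)) {φ ψ : G → ℝ}
    (hφ : BddMeas φ) (hψ : BddMeas ψ) :
    n * t * (∫ g, riskGap P l f z g ∂(μ.tilted φ) - ∫ g, riskGap P l f z g ∂(ν.tilted ψ)) ≤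
      n * t ^ 2 * psi t * (1 + t / 2) *
        (∫ g, ∫ g', empSqDist l f z g g' ∂(ν.tilted ψ) ∂(μ.tilted φ))
        + (1 + t * psi t * (1 + t / 2) ^ 2) * (klTilt μ φ + klTilt ν ψ + c) := by
  have := isProbabilityMeasure_tilted' (μ := μ) hφ
  have := isProbabilityMeasure_tilted' (μ := ν) hψ
  have h0 := h.bernstein_tilted hq hφ hψ
  have hB := BddMeas.lowerExponent (P := P) (β := t / (1 + t / 2)) (z := z) hq
  have h1 := integral_integral_tilted_le (μ := μ) (ν := ν)
    (h := lowerExponent P l f (t / (1 + t / 2)) z) hB hφ hψ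
  rw [integral_integral_lowerExponent hq] at h1
  have h2 := (lgm₂_le_iff (μ := μ) (ν := ν)
    (h := lowerExponent P l f (t / (1 + t / 2)) z) hB).2 h.lower
  have h3 := h1.trans (add_le_add_right h2 _)
  have h4 := mul_le_mul_of_nonneg_left h3
    (mul_nonneg (mul_nonneg ht.le (psi_nonneg t)) (sq_nonneg (1 + t / 2)))
  have h5 : 1 - t / (1 + t / 2) / 2 = 1 / (1 + t / 2) := by field_simp; ring
  rw [h5] at h4
  refine h0.trans ?_
  have h6 : ∀ A B : ℝ, t * psi t * (1 + t / 2) ^ 2 *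
      (n * (t / (1 + t / 2)) * (1 / (1 + t / 2) * A - B)) =
      n * t ^ 2 * psi t * A - n * t ^ 2 * psi t * (1 + t / 2) * B := by
    intro A B; field_simp
  rw [h6] at h4
  linarith

variable {lam : ℝ}

lemma integral_riskGap (hq : BddMeas fun q : G × (X × Y) => l q.2.2 (f q.1 q.2.1)) :
    ∫ g, riskGap P l f z g ∂μ = ∫ g, risk P l f g ∂μ - ∫ g, empRisk l f z g ∂μ :=
  integral_sub ((BddMeas.risk hq).integrable μ) ((BddMeas.empRisk hq z).integrable μ)

lemma bernstein_coeff_le (hn : 1 ≤ n) (hlam : 0 < lam) (ht : 4 * lam / n ≤ 0.76) :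
    n * (4 * lam / n) ^ 2 * psi (4 * lam / n) ≤ 128 * lam ^ 2 / n := by
  have hn0 : (0 : ℝ) < n := by positivity
  have e : n * (4 * lam / n) ^ 2 = 16 * lam ^ 2 / n := by field_simp; norm_num
  have h4 : (0 : ℝ) ≤ 16 * lam ^ 2 / n := by positivity
  have h5 := mul_le_mul_of_nonneg_left (psi_le (t := 4 * lam / n) (by positivity) ht) h4
  have h6 : 128 * lam ^ 2 / n = 8 * (16 * lam ^ 2 / n) := by ring
  rw [e, h6]
  linarith

/-- An empirical bound on the divergence of the posterior from the localized prior. -/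
lemma Deviation.klTilt_le (hn : 1 ≤ n) (hlam : 0 < lam) (hx : lam / n ≤ 0.19)
    (h : Deviation P l f μ μ (4 * lam / n) (4 * lam / n / (1 + 4 * lam / n / 2)) s c z)
    (hc : 0 ≤ c)
    (hq : BddMeas fun q : G × (X × Y) => l q.2.2 (f q.1 q.2.1)) :
    klTilt μ (fun g => lam * riskGap P l f z g) ≤
      2 * lgm (μ.tilted fun g => lam * riskGap P l f z g) (fun g₁ => 4 * lam ^ 2 / n *
        ∫ g₂, empSqDist l f z g₁ g₂ ∂(μ.tilted fun g => lam * riskGap P l f z g)) + c := by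
  have hn0 : (0 : ℝ) < n := by positivity
  have hd := BddMeas.riskGap (P := P) (z := z) hq
  have hφ := hd.const_mul lam
  set φ := fun g => lam * riskGap P l f z g with hφdef
  have := isProbabilityMeasure_tilted' (μ := μ) hφ
  have ht : 0 < 4 * lam / n := by positivity
  have ht1 : 4 * lam / n ≤ 0.76 := by rw [mul_div_assoc]; linarith
  have h1 := h.empirical_tilted ht hq hφ (BddMeas.const 0)
  have h0 : μ.tilted (fun _ => (0 : ℝ)) = μ := by simp
  rw [h0, klTilt_zero] at h1
  have hnt : n * (4 * lam / n) = 4 * lam := by field_simp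
  have hV0 : 0 ≤ ∫ g, ∫ g', empSqDist l f z g g' ∂μ ∂(μ.tilted φ) :=
    integral_nonneg fun _ => integral_nonneg fun _ => empSqDist_nonneg _ _ _
  have h2 : n * (4 * lam / n) ^ 2 * psi (4 * lam / n) * (1 + 4 * lam / n / 2) ≤
      16 * lam ^ 2 / n := by
    have e : n * (4 * lam / n) ^ 2 = 16 * lam ^ 2 / n := by field_simp; norm_num
    rw [mul_assoc, e]
    exact mul_le_of_le_one_right (by positivity) (psi_mul_le_one ht ht1)
  have h3 := mul_le_mul_of_nonneg_right h2 hV0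
  have hk := klTilt_nonneg (μ := μ) hφ
  have h4 := mul_le_mul_of_nonneg_right (add_le_add_right (mul_psi_mul_le_one ht ht1) 1)
    (by linarith : 0 ≤ klTilt μ φ + 0 + c)
  have hVρ : BddMeas fun g => ∫ g', empSqDist l f z g g' ∂(μ.tilted φ) :=
    BddMeas.integral (h := empSqDist l f z) (BddMeas.empSqDist hq z) _
  -- With ρ the tilted measure, the distance is charged to the reverse divergence KL(μ, ρ).
  have h5 := integral_le_lgm_tilted (μ := μ) hφ (hVρ.const_mul (4 * lam ^ 2 / n))
  rw [integral_const_mul, integral_integral_empSqDist_comm hq] at h5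
  have h6 : klTilt μ φ = lam * ∫ g, riskGap P l f z g ∂(μ.tilted φ) - lgm μ φ := by
    rw [klTilt, ← integral_const_mul]
  have h7 : ∫ g, φ g ∂μ = lam * ∫ g, riskGap P l f z g ∂μ := integral_const_mul _ _
  have h8 : 16 * lam ^ 2 / n = 4 * (4 * lam ^ 2 / n) := by ring
  rw [hnt] at h1
  rw [h8] at h3
  -- Here λ (∫ d dρ - ∫ d dμ) = KL(ρ, μ) + KL(μ, ρ). Four times this is at most 4 KL(μ, ρ) + 4𝒞 + 2
  -- KL(ρ, μ) + 2c, so the reverse divergence cancels.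
  nlinarith

/-- A bound on the complexity of the posterior in terms of the localized prior. -/
lemma Deviation.lgm_empSqDist_le (hn : 1 ≤ n) (hlam : 0 < lam) (hx : lam / n ≤ 0.19)
    (h : Deviation P l f μ μ (4 * lam / n) β (32 * (lam / n) ^ 2) c z)
    (hq : BddMeas fun q : G × (X × Y) => l q.2.2 (f q.1 q.2.1)) :
    lgm (μ.tilted fun g => lam * riskGap P l f z g) (fun g₁ => 4 * lam ^ 2 / n *
        ∫ g₂, empSqDist l f z g₁ g₂ ∂(μ.tilted fun g => lam * riskGap P l f z g)) ≤
      c + lgm₂ μ μ (fun g₁ g₂ => 128 * lam ^ 2 / n * sqDist P l f g₁ g₂) := by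
  have hn0 : (0 : ℝ) < n := by positivity
  have hd := BddMeas.riskGap (P := P) (z := z) hq
  have hφ := hd.const_mul lam
  set φ := fun g => lam * riskGap P l f z g with hφdef
  have := isProbabilityMeasure_tilted' (μ := μ) hφ
  have ht : 0 < 4 * lam / n := by positivity
  have ht1 : 4 * lam / n ≤ 0.76 := by rw [mul_div_assoc]; linarith
  have hQ := BddMeas.sqDist (P := P) hq
  have hV := BddMeas.empSqDist hq z
  have hB := BddMeas.bernsteinExponent (P := P) (t := 4 * lam / n) (z := z) hq
  have hE := BddMeas.upperExponent (P := P) (s := 32 * (lam / n) ^ 2) (z := z) hq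
  set ell := lgm₂ μ μ (fun g₁ g₂ => 128 * lam ^ 2 / n * sqDist P l f g₁ g₂) with hell
  set m := ∫ g, φ g ∂μ with hm
  -- the exponential moment of the centered gap
  have hM : lgm μ (fun g => 2 * φ g) - 2 * m ≤ 1 / 2 * c + 1 / 2 * ell := by
    have hk := (BddMeas.integral (h := sqDist P l f) hQ μ).const_mul
      (n * (4 * lam / n) ^ 2 * psi (4 * lam / n))
    have hb := BddMeas.integral (h := bernsteinExponent P l f (4 * lam / n) z) hB μ
    -- At t = 4λ/n, the Bernstein exponent averaged over its second argument is 4(φ - m) minus a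
    -- variance term. Half of it, plus half the variance term, is 2(φ - m).
    have e1 : (fun g => 2 * φ g) = fun g =>
        (1 / 2 * (∫ g', bernsteinExponent P l f (4 * lam / n) z g g' ∂μ) +
        1 / 2 * (n * (4 * lam / n) ^ 2 * psi (4 * lam / n) * ∫ g', sqDist P l f g g' ∂μ))
        + 2 * m := by
      funext g
      rw [integral_bernsteinExponent hq, hm, integral_const_mul, hφdef]
      have hnt : n * (4 * lam / n) = 4 * lam := by field_simp
      rw [hnt]; ring
    rw [e1, lgm_add_const ((hb.const_mul _).add (hk.const_mul _))]
    have h1 := lgm_midpoint_le (μ := μ) hb hk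
    have h2 := (lgm_integral_le (μ := μ) (ν := μ)
      (h := bernsteinExponent P l f (4 * lam / n) z) hB).trans
      ((lgm₂_le_iff (h := bernsteinExponent P l f (4 * lam / n) z) hB).2 h.bernstein)
    have h3 : n * (4 * lam / n) ^ 2 * psi (4 * lam / n) ≤ 128 * lam ^ 2 / n :=
      bernstein_coeff_le hn hlam ht1
    have h4 : lgm μ (fun g => n * (4 * lam / n) ^ 2 * psi (4 * lam / n) *
        ∫ g', sqDist P l f g g' ∂μ) ≤ ell := by
      refine (lgm_mono (k := fun g => ∫ g', 128 * lam ^ 2 / n * sqDist P l f g g' ∂μ) hk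
        (BddMeas.integral (h := fun g g' => 128 * lam ^ 2 / n * sqDist P l f g g')
          (hQ.const_mul _) μ) fun g => ?_).trans
        (lgm_integral_le (h := fun g g' => 128 * lam ^ 2 / n * sqDist P l f g g')
          (hQ.const_mul _))
      rw [integral_const_mul]
      exact mul_le_mul_of_nonneg_right h3 (integral_nonneg fun _ => sqDist_nonneg _ _)
    linarith
  have hmφ : m ≤ lgm μ φ := integral_le_lgm hφ
  have hKL : klTilt μ φ ≤ lgm μ (fun g => 2 * φ g) - 2 * m := by
    -- Testing against 2φ gives KL ≤ lgm(2φ) - 2 lgm(φ).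
    have h1 := integral_tilted_le (μ := μ) hφ (hφ.const_mul 2)
    rw [integral_const_mul] at h1
    have h2 : klTilt μ φ = ∫ g, φ g ∂(μ.tilted φ) - lgm μ φ := rfl
    linarith
  -- the exponential moment of the quadratic distance to the localized prior
  have hVμ : BddMeas fun g => ∫ g', empSqDist l f z g g' ∂μ :=
    BddMeas.integral (h := empSqDist l f z) hV μ
  have hVρ : BddMeas fun g => ∫ g', empSqDist l f z g g' ∂(μ.tilted φ) :=
    BddMeas.integral (h := empSqDist l f z) hV _
  set u := fun g => 16 * lam ^ 2 / n * ∫ g', empSqDist l f z g g' ∂μ with hu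
  have huB : BddMeas u := hVμ.const_mul _
  have hU : lgm μ u ≤ 1 / 2 * c + 1 / 2 * ell := by
    have hk : BddMeas fun p : G × G =>
      n * (Real.exp (32 * (lam / n) ^ 2) - 1) * sqDist P l f p.1 p.2 := hQ.const_mul _
    -- The value s = 32(λ/n)² is chosen so that ns/2 = 16λ²/n. It stays below 1.2 on the grid, where
    -- e^s - 1 ≤ 4s; hence the constant 128 = 4 · 32.
    have e1 : u = fun g => ∫ g', (1 / 2 * upperExponent P l f (32 * (lam / n) ^ 2) z g g' +
        1 / 2 * (n * (Real.exp (32 * (lam / n) ^ 2) - 1) * sqDist P l f g g')) ∂μ := by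
      funext g
      change 16 * lam ^ 2 / n * (∫ g', empSqDist l f z g g' ∂μ) = _
      rw [← integral_const_mul]
      congr 1 with g'
      rw [upperExponent]
      field_simp
      ring
    rw [e1]
    refine (lgm_integral_le (h := fun g g' =>
      1 / 2 * upperExponent P l f (32 * (lam / n) ^ 2) z g g' +
        1 / 2 * (n * (Real.exp (32 * (lam / n) ^ 2) - 1) * sqDist P l f g g'))
      ((hE.const_mul _).add (hk.const_mul _))).trans ?_
    have h1 := lgm₂_midpoint_le (μ := μ) (ν := μ)
      (h := upperExponent P l f (32 * (lam / n) ^ 2) z)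
      (k := fun g g' => n * (Real.exp (32 * (lam / n) ^ 2) - 1) * sqDist P l f g g') hE hk
    have h2 := (lgm₂_le_iff (h := upperExponent P l f (32 * (lam / n) ^ 2) z) hE).2 h.upper
    have h3 : n * (Real.exp (32 * (lam / n) ^ 2) - 1) ≤ 128 * lam ^ 2 / n := by
      have hx0 : 0 ≤ lam / n := by positivity
      have h4 := exp_sub_one_le (s := 32 * (lam / n) ^ 2) (by positivity) (by nlinarith)
      have h5 : 128 * lam ^ 2 / n = n * (4 * (32 * (lam / n) ^ 2)) := by field_simp; ring
      rw [h5]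
      exact mul_le_mul_of_nonneg_left h4 hn0.le
    have h4 := lgm₂_mono (μ := μ) (ν := μ)
      (h := fun g g' => n * (Real.exp (32 * (lam / n) ^ 2) - 1) * sqDist P l f g g')
      (k := fun g₁ g₂ => 128 * lam ^ 2 / n * sqDist P l f g₁ g₂) hk (hQ.const_mul _)
      fun a b => mul_le_mul_of_nonneg_right h3 (sqDist_nonneg _ _)
    linarith
  set h₀ := fun g₁ => 4 * lam ^ 2 / n * ∫ g₂, empSqDist l f z g₁ g₂ ∂(μ.tilted φ) with hh₀
  have hh₀B : BddMeas h₀ := hVρ.const_mul _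
  -- The quasi-triangle inequality through a μ-distributed point replaces distances between two
  -- posterior draws by distances to the prior.
  have h2h : lgm μ (fun g => 2 * h₀ g) ≤ lgm μ u + ∫ g, u g ∂(μ.tilted φ) := by
    rw [← lgm_add_const huB]
    refine lgm_mono (hh₀B.const_mul 2) (huB.add (BddMeas.const _)) fun g => ?_
    have hpt : ∀ g₂, empSqDist l f z g g₂ ≤
        2 * (∫ g', empSqDist l f z g g' ∂μ) + 2 * ∫ g', empSqDist l f z g₂ g' ∂μ := fun g₂ => by
      have hg := (BddMeas.right (h := empSqDist l f z) hV g).const_mul 2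
      have hg₂ := (BddMeas.right (h := empSqDist l f z) hV g₂).const_mul 2
      have := integral_mono (μ := μ) (integrable_const (empSqDist l f z g g₂))
        ((hg.add hg₂).integrable μ) fun g' => by
          have := empSqDist_triangle (l := l) (f := f) z g g' g₂
          rwa [empSqDist_comm z g' g₂] at this
      rw [integral_add (hg.integrable μ) (hg₂.integrable μ), integral_const_mul,
        integral_const_mul] at this
      simpa using this
    have h1 := integral_mono (μ := μ.tilted φ)
      ((BddMeas.right (h := empSqDist l f z) hV g).integrable _)
      (((BddMeas.const _).add (hVμ.const_mul 2)).integrable _) hpt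
    rw [integral_add (integrable_const _) ((hVμ.const_mul 2).integrable _)] at h1
    simp only [integral_const_mul, integral_const, probReal_univ, smul_eq_mul, one_mul] at h1
    have h2 := mul_le_mul_of_nonneg_left h1 (by positivity : 0 ≤ 8 * lam ^ 2 / n)
    rw [hu, integral_const_mul, hh₀]
    refine le_trans (le_of_eq ?_) (h2.trans (le_of_eq ?_)) <;> ring
  have h3 := integral_tilted_le (μ := μ) hφ huB
  -- Convexity separates the distance from the tilt, so that each can be bounded under μ.
  have h4 := lgm_midpoint_le (μ := μ) (hh₀B.const_mul 2) (hφ.const_mul 2)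
  have e : (fun g => 1 / 2 * (2 * h₀ g) + 1 / 2 * (2 * φ g)) = fun g => h₀ g + φ g := by
    funext g; ring
  rw [e] at h4
  rw [lgm_tilted hφ hh₀B]
  linarith

/-- A risk bound for the posterior at inverse temperature `lam'` relative to the localized prior
at inverse temperature `lam`. -/
lemma Deviation.risk_tilted_le (hn : 1 ≤ n) (hlam : 0 < lam) (hx : lam / n ≤ 0.19) {lam' : ℝ}
    (hlam' : lam ≤ lam') (hlam2 : lam' ≤ 2 * lam)
    (h : Deviation P l f μ μ (4 * lam / n) β s c z) (hc : 0 ≤ c)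
    (hq : BddMeas fun q : G × (X × Y) => l q.2.2 (f q.1 q.2.1)) :
    (lam' - lam) * (∫ g, risk P l f g
        ∂(μ.tilted fun g => lam * risk P l f g - lam' * empRisk l f z g)
      - ∫ g, risk P l f g ∂μ) ≤
      1 / 2 * c + 1 / 2 * lgm₂ μ μ (fun g₁ g₂ => 128 * lam ^ 2 / n * sqDist P l f g₁ g₂) := by
  have hn0 : (0 : ℝ) < n := by positivity
  have hR := BddMeas.risk (P := P) hq
  have hr := BddMeas.empRisk hq z
  have hφ := (hR.const_mul lam).sub (hr.const_mul lam')
  set φ := fun g => lam * risk P l f g - lam' * empRisk l f z g with hφdef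
  have := isProbabilityMeasure_tilted' (μ := μ) hφ
  have ht : 0 < 4 * lam / n := by positivity
  have ht1 : 4 * lam / n ≤ 0.76 := by rw [mul_div_assoc]; linarith
  have hQ := BddMeas.sqDist (P := P) hq
  have h1 := h.bernstein_tilted hq hφ (BddMeas.const 0)
  have h0 : μ.tilted (fun _ => (0 : ℝ)) = μ := by simp
  rw [h0, klTilt_zero] at h1
  have hnt : n * (4 * lam / n) = 4 * lam := by field_simp
  rw [hnt, integral_riskGap hq, integral_riskGap hq] at h1
  have hk := klTilt_nonneg (μ := μ) hφ
  have hkl : klTilt μ φ ≤ ∫ g, φ g ∂(μ.tilted φ) - ∫ g, φ g ∂μ :=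
    sub_le_sub_left (integral_le_lgm hφ) _
  have hint : ∀ κ : Measure G, IsProbabilityMeasure κ → ∫ g, φ g ∂κ =
      lam * (∫ g, risk P l f g ∂κ) - lam' * ∫ g, empRisk l f z g ∂κ := fun κ _ => by
    rw [hφdef, integral_sub ((hR.const_mul _).integrable κ) ((hr.const_mul _).integrable κ),
      integral_const_mul, integral_const_mul]
  rw [hint _ this, hint μ inferInstance] at hkl
  have hQQ : n * (4 * lam / n) ^ 2 * psi (4 * lam / n) *
      (∫ g, ∫ g', sqDist P l f g g' ∂μ ∂(μ.tilted φ)) ≤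
      klTilt μ φ + lgm₂ μ μ (fun g₁ g₂ => 128 * lam ^ 2 / n * sqDist P l f g₁ g₂) := by
    have h3 : n * (4 * lam / n) ^ 2 * psi (4 * lam / n) ≤ 128 * lam ^ 2 / n :=
      bernstein_coeff_le hn hlam ht1
    have hQ0 : 0 ≤ ∫ g, ∫ g', sqDist P l f g g' ∂μ ∂(μ.tilted φ) :=
      integral_nonneg fun _ => integral_nonneg fun _ => sqDist_nonneg _ _
    have h4 := integral_integral_tilted_le (μ := μ) (ν := μ)
      (h := fun g₁ g₂ => 128 * lam ^ 2 / n * sqDist P l f g₁ g₂) (hQ.const_mul _) hφ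
      (BddMeas.const 0)
    rw [h0, klTilt_zero] at h4
    simp only [integral_const_mul] at h4
    linarith [mul_le_mul_of_nonneg_right h3 hQ0]
  have hA : 0 ≤ n * (4 * lam / n) ^ 2 * psi (4 * lam / n) *
      (∫ g, ∫ g', sqDist P l f g g' ∂μ ∂(μ.tilted φ)) :=
    mul_nonneg (mul_nonneg (by positivity) (psi_nonneg _))
      (integral_nonneg fun _ => integral_nonneg fun _ => sqDist_nonneg _ _)
  set A := n * (4 * lam / n) ^ 2 * psi (4 * lam / n) *
      (∫ g, ∫ g', sqDist P l f g g' ∂μ ∂(μ.tilted φ))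
  set D := ((∫ g, risk P l f g ∂(μ.tilted φ)) - ∫ g, empRisk l f z g ∂(μ.tilted φ)) -
      ((∫ g, risk P l f g ∂μ) - ∫ g, empRisk l f z g ∂μ) with hD
  -- For D ≥ 0 this is where λ' ≤ 2λ enters: Bernstein controls 4λD, hence 2λ'D.
  have h5 : lam' * D ≤ 1 / 2 * (A + (klTilt μ φ + 0 + c)) := by
    rcases le_total D 0 with hD0 | hD0
    · have := mul_nonpos_of_nonneg_of_nonpos (hlam.le.trans hlam') hD0
      linarith
    · have := mul_le_mul_of_nonneg_right hlam2 hD0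
      linarith
  have h6 : lam' * D = lam' * ((∫ g, risk P l f g ∂(μ.tilted φ)) - ∫ g, risk P l f g ∂μ)
    - lam' * ((∫ g, empRisk l f z g ∂(μ.tilted φ)) - ∫ g, empRisk l f z g ∂μ) := by
    rw [hD]; ring
  -- `hQQ` and `h5` give λ'D ≤ KL plus half of c and of the log-Laplace term. Inserting `hkl`
  -- cancels the empirical risks and leaves the factor λ' - λ.
  linarith

end Consequences

/-! ### The grid of inverse temperatures -/

lemma invTemp_pos {n : ℕ} (hn : 1 ≤ n) (j : ℕ) : 0 < invTemp n j := by
  have : (0 : ℝ) < n := by positivity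
  unfold invTemp; positivity

lemma invTemp_mono (n : ℕ) : Monotone (invTemp n) := fun i j hij => by
  unfold invTemp
  gcongr

lemma invTemp_lt {n i j : ℕ} (hn : 1 ≤ n) (hij : i < j) : invTemp n i < invTemp n j := by
  have hn0 : (0 : ℝ) < n := by positivity
  unfold invTemp
  gcongr

/-- The cutoff j ≤ log n means e^{j/2} ≤ √n; this keeps all arguments of Ψ in the range where the
numerical bounds hold. -/
lemma invTemp_div_le {n j : ℕ} (hn : 1 ≤ n) (hj : (j : ℝ) ≤ Real.log n) :
    invTemp n j / n ≤ 0.19 := by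
  have hn0 : (0 : ℝ) < n := by positivity
  have h1 : Real.exp ((j : ℝ) / 2) ≤ Real.sqrt n := by
    apply Real.le_sqrt_of_sq_le
    rw [← Real.exp_nat_mul]
    calc Real.exp (((2 : ℕ) : ℝ) * (j / 2)) = Real.exp j := by congr 1; push_cast; ring
      _ ≤ Real.exp (Real.log n) := Real.exp_le_exp.2 hj
      _ = n := Real.exp_log hn0
  rw [div_le_iff₀ hn0, invTemp]
  calc 0.19 * Real.sqrt n * Real.exp ((j : ℝ) / 2) ≤ 0.19 * Real.sqrt n * Real.sqrt n := by gcongr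
    _ = 0.19 * n := by rw [mul_assoc, Real.mul_self_sqrt hn0.le]

lemma invTemp_succ (n j : ℕ) : invTemp n (j + 1) = Real.exp (1 / 2) * invTemp n j := by
  rw [invTemp, invTemp, mul_left_comm, ← Real.exp_add]
  congr 2; push_cast; ring

lemma exp_half_bounds : 3 / 2 ≤ Real.exp (1 / 2) ∧ Real.exp (1 / 2) ≤ 2 := by
  constructor
  · linarith [Real.add_one_le_exp (1 / 2 : ℝ)]
  · have := Real.exp_bound_div_one_sub_of_interval (x := 1 / 2) (by norm_num) (by norm_num)
    norm_num at this ⊢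
    exact this

lemma coefB_nonneg {n : ℕ} {lam : ℝ} (hlam : 0 ≤ lam) : 0 ≤ coefB n lam :=
  mul_nonneg (by positivity) (add_nonneg zero_le_one
    (mul_nonneg (mul_nonneg (by positivity) (psi_nonneg _)) (by positivity)))

lemma coefA_le {n : ℕ} {lam : ℝ} (hn : 1 ≤ n) (hlam : 0 < lam) (hx : lam / n ≤ 0.19) :
    coefA n lam ≤ lam / n := by
  have hn0 : (0 : ℝ) < n := by positivity
  have h0 : 0 < lam / n := by positivity
  have := psi_mul_le_one h0 (hx.trans (by norm_num))
  have e : lam / (2 * n) = lam / n / 2 := by field_simp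
  rw [coefA, e, mul_assoc]
  exact mul_le_of_le_one_right h0.le this

lemma coefB_le {n : ℕ} {lam : ℝ} (hn : 1 ≤ n) (hlam : 0 < lam) (hx : lam / n ≤ 0.19) :
    coefB n lam ≤ 4 / lam := by
  have hn0 : (0 : ℝ) < n := by positivity
  have h0 : 0 < lam / n := by positivity
  have := mul_psi_mul_le_one h0 (hx.trans (by norm_num))
  have e : lam / (2 * n) = lam / n / 2 := by field_simp
  rw [coefB, e]
  calc 2 / lam * (1 + lam / n * psi (lam / n) * (1 + lam / n / 2) ^ 2) ≤ 2 / lam * (1 + 1) := by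
        gcongr
    _ = 4 / lam := by ring

/-- The argument `λ / n` at which the deviation inequalities are used for the pair `(i, j)`. -/
noncomputable def pairTemp (n i j : ℕ) : ℝ :=
  -- Diagonal pairs serve the divergence, complexity and prior comparison bounds, which need 4λ/n;
  -- the others compare two posteriors at the larger temperature. One value per pair keeps the union
  -- bound at three events for each.
  if i = j then 4 * invTemp n j / n else invTemp n (max i j) / n

lemma pairTemp_pos {n : ℕ} (hn : 1 ≤ n) (i j : ℕ) : 0 < pairTemp n i j := by
  have h1 := invTemp_pos hn j
  have h2 := invTemp_pos hn (max i j)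
  have : (0 : ℝ) < n := by positivity
  unfold pairTemp
  split_ifs <;> positivity

/-! ### The good event and the comparison of posteriors -/

section Sample

variable {X Y G : Type*} [MeasurableSpace X] [MeasurableSpace Y] [MeasurableSpace G]

/-- All the deviation inequalities used in the analysis of the selection scheme. -/
def GoodSample (P : Measure (X × Y)) (π : Measure G) (l : Y → Y → ℝ) (f : G → X → Y) {n : ℕ}
    (c : ℝ) (z : Fin n → X × Y) : Prop :=
  ∀ i j : ℕ, (i : ℝ) ≤ Real.log n → (j : ℝ) ≤ Real.log n →
    Deviation P l f (localPrior π P l f n i) (localPrior π P l f n j) (pairTemp n i j)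
      (pairTemp n i j / (1 + pairTemp n i j / 2)) (32 * (invTemp n j / n) ^ 2) c z

variable {P : Measure (X × Y)} [IsProbabilityMeasure P] {π : Measure G} [IsProbabilityMeasure π]
  {l : Y → Y → ℝ} {f : G → X → Y} {n : ℕ} {z : Fin n → X × Y}

lemma isProbabilityMeasure_localPrior
    (hq : BddMeas fun q : G × (X × Y) => l q.2.2 (f q.1 q.2.1)) (j : ℕ) :
    IsProbabilityMeasure (localPrior π P l f n j) :=
  isProbabilityMeasure_tilted' ((BddMeas.risk hq).const_mul _)

omit [MeasurableSpace X] [MeasurableSpace Y] in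
lemma isProbabilityMeasure_posterior (hr : BddMeas (empRisk l f z)) (j : ℕ) :
    IsProbabilityMeasure (posterior π l f z j) :=
  isProbabilityMeasure_tilted' (hr.const_mul _)

lemma posterior_eq_tilted_localPrior
    (hq : BddMeas fun q : G × (X × Y) => l q.2.2 (f q.1 q.2.1)) (i j : ℕ) :
    posterior π l f z j = (localPrior π P l f n i).tilted
      (fun g => invTemp n i * risk P l f g - invTemp n j * empRisk l f z g) := by
  rw [localPrior, gibbs, tilted_tilted (((BddMeas.risk hq).const_mul _).exp.integrable π),
    posterior, gibbs]
  congr 1 with g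
  simp only [Pi.add_apply]
  ring

lemma posterior_eq_tilted_riskGap
    (hq : BddMeas fun q : G × (X × Y) => l q.2.2 (f q.1 q.2.1)) (j : ℕ) :
    posterior π l f z j = (localPrior π P l f n j).tilted
      (fun g => invTemp n j * riskGap P l f z g) := by
  rw [posterior_eq_tilted_localPrior (P := P) hq j j]
  congr 1 with g
  rw [riskGap]; ring

omit [MeasurableSpace X] [MeasurableSpace Y] in
lemma posterior_eq_tilted_posterior (hr : BddMeas (empRisk l f z)) (i j : ℕ) :
    posterior π l f z i = (posterior π l f z j).tilted
      (fun g => (invTemp n j - invTemp n i) * empRisk l f z g) := by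
  rw [posterior, posterior, gibbs, gibbs, tilted_tilted ((hr.const_mul _).exp.integrable π)]
  congr 1 with g
  simp only [Pi.add_apply]
  ring

lemma complexity_nonneg (hq : BddMeas fun q : G × (X × Y) => l q.2.2 (f q.1 q.2.1)) (j : ℕ) :
    0 ≤ complexity π l f z j := by
  have := isProbabilityMeasure_posterior (π := π) (BddMeas.empRisk hq z) j
  exact lgm_nonneg (μ := posterior π l f z j) ((BddMeas.integral (h := empSqDist l f z)
    (BddMeas.empSqDist hq z) _).const_mul (4 * invTemp n j ^ 2 / n))
    fun g => mul_nonneg (by positivity) (integral_nonneg fun _ => empSqDist_nonneg _ _ _)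

/-- Union bound over at most log²(en) pairs, each failing with probability at most 3e^{-L}; L is
calibrated so that the total is ε. -/
lemma measure_goodSample (hn : 1 ≤ n)
    (hq : BddMeas fun q : G × (X × Y) => l q.2.2 (f q.1 q.2.1))
    (hl01 : ∀ y y', 0 ≤ l y y' ∧ l y y' ≤ 1) {ε : ℝ} (hε : 0 < ε) :
    MeasurableSet {z : Fin n → X × Y | GoodSample P π l f (confTerm n ε) z} ∧
      1 - ε ≤ (Measure.pi fun _ => P).real
        {z : Fin n → X × Y | GoodSample P π l f (confTerm n ε) z} := by
  have hn0 : (0 : ℝ) < n := by positivity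
  have hlog : 0 ≤ Real.log n := Real.log_nonneg (by exact_mod_cast hn)
  set N := ⌊Real.log n⌋₊ + 1 with hN
  set D : ℕ × ℕ → Set (Fin n → X × Y) := fun p => {z | Deviation P l f
    (localPrior π P l f n p.1) (localPrior π P l f n p.2) (pairTemp n p.1 p.2)
      (pairTemp n p.1 p.2 / (1 + pairTemp n p.1 p.2 / 2)) (32 * (invTemp n p.2 / n) ^ 2)
      (confTerm n ε) z} with hD
  have hprob := fun j => isProbabilityMeasure_localPrior (P := P) (π := π) (n := n) hq j
  have hdev : ∀ p, MeasurableSet (D p) ∧ (Measure.pi fun _ => P).real (D p)ᶜ ≤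
      3 * Real.exp (-confTerm n ε) := fun p => by
    have h1 := hprob p.1
    have h2 := hprob p.2
    have h3 := pairTemp_pos hn p.1 p.2
    exact measure_compl_deviation_le hn hq hl01 _ _ h3 (by positivity) _ _
  have heq : {z : Fin n → X × Y | GoodSample P π l f (confTerm n ε) z} =
      ⋂ p ∈ Finset.range N ×ˢ Finset.range N, D p := by
    ext z
    simp only [hD, GoodSample, Set.mem_ofPred_eq, Set.mem_iInter, Finset.mem_product,
      Finset.mem_range, hN, Nat.lt_succ_iff, Nat.le_floor_iff hlog, Prod.forall, and_imp]
  have hmeas : MeasurableSet (⋂ p ∈ Finset.range N ×ˢ Finset.range N, D p) :=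
    Finset.measurableSet_biInter _ fun p _ => (hdev p).1
  rw [heq]
  refine ⟨hmeas, ?_⟩
  have hcompl : (Measure.pi fun _ => P).real
      (⋂ p ∈ Finset.range N ×ˢ Finset.range N, D p)ᶜ ≤ ε := by
    simp only [Set.compl_iInter]
    refine (measureReal_biUnion_finset_le _ _).trans ?_
    refine (Finset.sum_le_sum fun p _ => (hdev p).2).trans ?_
    have hlog' : Real.log (Real.exp 1 * n) = 1 + Real.log n := by
      rw [Real.log_mul (Real.exp_pos 1).ne' hn0.ne', Real.log_exp]
    have hexp : Real.exp (-confTerm n ε) = ε / (3 * (1 + Real.log n) ^ 2) := by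
      rw [confTerm, hlog', Real.exp_neg, Real.exp_log (by positivity)]
      field_simp
    have hNle : (N : ℝ) ≤ 1 + Real.log n := by
      rw [hN]; push_cast
      linarith [Nat.floor_le hlog]
    rw [Finset.sum_const, Finset.card_product, Finset.card_range, nsmul_eq_mul, hexp]
    have h3 : (N : ℝ) * N ≤ (1 + Real.log n) ^ 2 := by
      rw [← sq]; gcongr
    have h4 : (3 : ℝ) * (ε / (3 * (1 + Real.log n) ^ 2)) = ε / (1 + Real.log n) ^ 2 := by
      field_simp
    push_cast
    rw [h4, mul_div_assoc', div_le_iff₀ (by positivity), mul_comm ε]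
    exact mul_le_mul_of_nonneg_right h3 hε.le
  rw [probReal_compl_eq_one_sub hmeas] at hcompl
  linarith

variable {c ε : ℝ}

lemma GoodSample.klTilt_le (h : GoodSample P π l f c z) (hn : 1 ≤ n) (hc : 0 ≤ c)
    (hq : BddMeas fun q : G × (X × Y) => l q.2.2 (f q.1 q.2.1)) {j : ℕ}
    (hj : (j : ℝ) ≤ Real.log n) :
    klTilt (localPrior π P l f n j) (fun g => invTemp n j * riskGap P l f z g) ≤
      2 * complexity π l f z j + c := by
  have := isProbabilityMeasure_localPrior (P := P) (π := π) (n := n) hq j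
  have h1 := h j j hj hj
  rw [pairTemp, if_pos rfl] at h1
  have h2 := h1.klTilt_le hn (invTemp_pos hn j) (invTemp_div_le hn hj) hc hq
  rwa [← posterior_eq_tilted_riskGap hq] at h2

lemma GoodSample.complexity_le (h : GoodSample P π l f c z) (hn : 1 ≤ n)
    (hq : BddMeas fun q : G × (X × Y) => l q.2.2 (f q.1 q.2.1)) {j : ℕ}
    (hj : (j : ℝ) ≤ Real.log n) :
    complexity π l f z j ≤ c + lgm₂ (localPrior π P l f n j) (localPrior π P l f n j)
      (fun g₁ g₂ => 128 * invTemp n j ^ 2 / n * sqDist P l f g₁ g₂) := by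
  have := isProbabilityMeasure_localPrior (P := P) (π := π) (n := n) hq j
  have h1 := h j j hj hj
  rw [pairTemp, if_pos rfl] at h1
  have h2 := h1.lgm_empSqDist_le hn (invTemp_pos hn j) (invTemp_div_le hn hj) hq
  rwa [← posterior_eq_tilted_riskGap hq] at h2

/-- The empirical Bernstein bound at λ/n, divided by λ, with both divergences replaced by 2𝒞 + c.
The three copies of c that appear are rounded up to four, giving 2(𝒞(i) + 𝒞(j) + 2c). -/
lemma GoodSample.riskGap_sub_le (h : GoodSample P π l f c z) (hn : 1 ≤ n) (hc : 0 ≤ c)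
    (hq : BddMeas fun q : G × (X × Y) => l q.2.2 (f q.1 q.2.1)) {i j : ℕ} (hij : i ≠ j)
    (hi : (i : ℝ) ≤ Real.log n) (hj : (j : ℝ) ≤ Real.log n) :
    ∫ g, riskGap P l f z g ∂(posterior π l f z i) - ∫ g, riskGap P l f z g ∂(posterior π l f z j)
      ≤ coefA n (invTemp n (max i j)) *
        (∫ g₁, ∫ g₂, empSqDist l f z g₁ g₂ ∂(posterior π l f z j) ∂(posterior π l f z i))
      + coefB n (invTemp n (max i j)) *
        (complexity π l f z i + complexity π l f z j + 2 * c) := by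
  have hn0 : (0 : ℝ) < n := by positivity
  have := isProbabilityMeasure_localPrior (P := P) (π := π) (n := n) hq i
  have := isProbabilityMeasure_localPrior (P := P) (π := π) (n := n) hq j
  have hd := BddMeas.riskGap (P := P) (z := z) hq
  have h1 := (h i j hi hj).empirical_tilted (pairTemp_pos hn i j) hq
    (hd.const_mul (invTemp n i)) (hd.const_mul (invTemp n j))
  rw [← posterior_eq_tilted_riskGap hq, ← posterior_eq_tilted_riskGap hq, pairTemp,
    if_neg hij] at h1
  set lam := invTemp n (max i j) with hlamdef
  have hlam : 0 < lam := invTemp_pos hn _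
  have e1 : (n : ℝ) * (lam / n) = lam := by field_simp
  have e2 : n * (lam / n) ^ 2 * psi (lam / n) * (1 + lam / n / 2) = lam * coefA n lam := by
    rw [coefA]; field_simp
  have e3 : 1 + lam / n * psi (lam / n) * (1 + lam / n / 2) ^ 2 = lam * (coefB n lam / 2) := by
    rw [coefB]; field_simp
  rw [e1, e2, e3] at h1
  have h2 := h.klTilt_le hn hc hq hi
  have h3 := h.klTilt_le hn hc hq hj
  have h4 : lam * (coefB n lam / 2) *
      (klTilt (localPrior π P l f n i) (fun g => invTemp n i * riskGap P l f z g) +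
      klTilt (localPrior π P l f n j) (fun g => invTemp n j * riskGap P l f z g) + c) ≤
      lam * (coefB n lam / 2) *
        (2 * (complexity π l f z i + complexity π l f z j + 2 * c)) := by
    refine mul_le_mul_of_nonneg_left (by linarith) (mul_nonneg hlam.le ?_)
    linarith [coefB_nonneg (n := n) hlam.le]
  refine le_of_mul_le_mul_left ?_ hlam
  refine (h1.trans (add_le_add_right h4 _)).trans (le_of_eq ?_)
  ring

/-- The comparison term controls the difference of the risk gaps of two posteriors. -/
lemma GoodSample.abs_riskGap_sub_le (h : GoodSample P π l f (confTerm n ε) z) (hn : 1 ≤ n)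
    (hc : 0 ≤ confTerm n ε)
    (hq : BddMeas fun q : G × (X × Y) => l q.2.2 (f q.1 q.2.1)) {i j : ℕ} (hij : i < j)
    (hj : (j : ℝ) ≤ Real.log n) :
    |∫ g, riskGap P l f z g ∂(posterior π l f z j)
      - ∫ g, riskGap P l f z g ∂(posterior π l f z i)| ≤ compTerm π l f ε z i j := by
  have hi : (i : ℝ) ≤ Real.log n := le_trans (by exact_mod_cast hij.le) hj
  have := isProbabilityMeasure_posterior (π := π) (BddMeas.empRisk hq z) i
  have := isProbabilityMeasure_posterior (π := π) (BddMeas.empRisk hq z) j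
  have h1 := h.riskGap_sub_le hn hc hq hij.ne hi hj
  have h2 := h.riskGap_sub_le hn hc hq hij.ne' hj hi
  rw [max_eq_right hij.le] at h1
  rw [max_eq_left hij.le, integral_integral_empSqDist_comm hq] at h2
  rw [compTerm, abs_le]
  constructor <;> linarith

omit [IsProbabilityMeasure π] in
lemma riskGap_posterior (hq : BddMeas fun q : G × (X × Y) => l q.2.2 (f q.1 q.2.1)) (j : ℕ)
    [IsProbabilityMeasure (posterior π l f z j)] :
    ∫ g, riskGap P l f z g ∂(posterior π l f z j) =
      ∫ g, risk P l f g ∂(posterior π l f z j) - ∫ g, empRisk l f z g ∂(posterior π l f z j) :=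
  integral_riskGap hq

/-- Selected temperatures decrease the risk. -/
lemma GoodSample.risk_le_of_mem_candidates (h : GoodSample P π l f (confTerm n ε) z) (hn : 1 ≤ n)
    (hc : 0 ≤ confTerm n ε)
    (hq : BddMeas fun q : G × (X × Y) => l q.2.2 (f q.1 q.2.1)) {i j : ℕ}
    (hj : j ∈ candidates π l f ε z i) :
    ∫ g, risk P l f g ∂(posterior π l f z j) ≤ ∫ g, risk P l f g ∂(posterior π l f z i) := by
  obtain ⟨hij, hjn, hle⟩ := hj
  have := isProbabilityMeasure_posterior (π := π) (BddMeas.empRisk hq z) i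
  have := isProbabilityMeasure_posterior (π := π) (BddMeas.empRisk hq z) j
  have h1 := (abs_le.1 (h.abs_riskGap_sub_le hn hc hq hij hjn)).2
  rw [riskGap_posterior hq, riskGap_posterior hq] at h1
  linarith

/-- Donsker-Varadhan for ρ_i relative to ρ_j. Since ρ_i is ρ_j tilted by (λ_j - λ_i) r, Jensen
bounds the divergence by (λ_j - λ_i) times the difference of empirical risks. -/
lemma integral_empSqDist_posterior_le
    (hq : BddMeas fun q : G × (X × Y) => l q.2.2 (f q.1 q.2.1)) (i j : ℕ) :
    4 * invTemp n j ^ 2 / n *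
      (∫ g₁, ∫ g₂, empSqDist l f z g₁ g₂ ∂(posterior π l f z j) ∂(posterior π l f z i)) ≤
      (invTemp n j - invTemp n i) * (∫ g, empRisk l f z g ∂(posterior π l f z i)
        - ∫ g, empRisk l f z g ∂(posterior π l f z j)) + complexity π l f z j := by
  have hr := BddMeas.empRisk hq z
  have := isProbabilityMeasure_posterior (π := π) hr j
  have hφ := hr.const_mul (invTemp n j - invTemp n i)
  have hV := (BddMeas.integral (h := empSqDist l f z)
    (BddMeas.empSqDist hq z) (posterior π l f z j)).const_mul (4 * invTemp n j ^ 2 / n)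
  have h1 := integral_tilted_le (μ := posterior π l f z j) hφ hV
  have h2 := integral_le_lgm (μ := posterior π l f z j) hφ
  rw [klTilt, ← posterior_eq_tilted_posterior hr i j, integral_const_mul, integral_const_mul] at h1
  rw [integral_const_mul] at h2
  have h3 : lgm (posterior π l f z j) (fun g => 4 * invTemp n j ^ 2 / n *
    ∫ g₂, empSqDist l f z g g₂ ∂(posterior π l f z j)) = complexity π l f z j := rfl
  linarith

/-- If `j` is rejected when the current temperature is `λ_i`, then `λ_i` is nearly as good. -/
lemma GoodSample.risk_le_of_notMem_candidates (h : GoodSample P π l f (confTerm n ε) z)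
    (hn : 1 ≤ n) (hc : 0 ≤ confTerm n ε)
    (hq : BddMeas fun q : G × (X × Y) => l q.2.2 (f q.1 q.2.1)) {i j : ℕ} (hij : i < j)
    (hjn : (j : ℝ) ≤ Real.log n) (hj : j ∉ candidates π l f ε z i) :
    ∫ g, risk P l f g ∂(posterior π l f z i) ≤ ∫ g, risk P l f g ∂(posterior π l f z j)
      + (1 / invTemp n j) * (12 * complexity π l f z i + 12 * complexity π l f z j
        + 24 * confTerm n ε) := by
  have hn0 : (0 : ℝ) < n := by positivity
  have := isProbabilityMeasure_posterior (π := π) (BddMeas.empRisk hq z) i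
  have := isProbabilityMeasure_posterior (π := π) (BddMeas.empRisk hq z) j
  have h1 := (abs_le.1 (h.abs_riskGap_sub_le hn hc hq hij hjn)).1
  rw [riskGap_posterior hq, riskGap_posterior hq] at h1
  have h2 : 0 < (∫ g, empRisk l f z g ∂(posterior π l f z j))
      - (∫ g, empRisk l f z g ∂(posterior π l f z i)) + compTerm π l f ε z i j := by
    by_contra hcon
    exact hj ⟨hij, hjn, not_lt.1 hcon⟩
  have hV := integral_empSqDist_posterior_le (π := π) (z := z) hq i j
  have hV0 : 0 ≤ ∫ g₁, ∫ g₂, empSqDist l f z g₁ g₂ ∂(posterior π l f z j)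
      ∂(posterior π l f z i) :=
    integral_nonneg fun _ => integral_nonneg fun _ => empSqDist_nonneg _ _ _
  have hCi := complexity_nonneg (π := π) (z := z) hq i
  have hCj := complexity_nonneg (π := π) (z := z) hq j
  have hlam := invTemp_pos hn j
  have hlami := invTemp_pos hn i
  have hlt := sub_pos.2 (invTemp_lt hn hij)
  have hA := coefA_le hn hlam (invTemp_div_le hn hjn)
  have hB := coefB_le hn hlam (invTemp_div_le hn hjn)
  rw [compTerm] at h1 h2
  set Ri := ∫ g, risk P l f g ∂(posterior π l f z i)
  set Rj := ∫ g, risk P l f g ∂(posterior π l f z j)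
  set ri := ∫ g, empRisk l f z g ∂(posterior π l f z i)
  set rj := ∫ g, empRisk l f z g ∂(posterior π l f z j)
  set V := ∫ g₁, ∫ g₂, empSqDist l f z g₁ g₂ ∂(posterior π l f z j) ∂(posterior π l f z i)
  set Ci := complexity π l f z i
  set Cj := complexity π l f z j
  set L := confTerm n ε
  set lam := invTemp n j
  have hri : 0 ≤ ri - rj := by
    have hr := BddMeas.empRisk hq z
    have hφ := hr.const_mul (lam - invTemp n i)
    have h5 := klTilt_nonneg (μ := posterior π l f z j) hφ
    have h6 := integral_le_lgm (μ := posterior π l f z j) hφ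
    rw [klTilt, ← posterior_eq_tilted_posterior hr i j, integral_const_mul] at h5
    rw [integral_const_mul] at h6
    refine (mul_nonneg_iff_of_pos_left hlt).1 ?_
    rw [mul_sub]; linarith
  have hV2 : 4 * lam ^ 2 / n * V ≤ lam * (ri - rj) + Cj :=
    hV.trans (add_le_add_left (mul_le_mul_of_nonneg_right (by linarith) hri) _)
  -- As rejection means ri - rj < S, the variance part of S is at most S/4 plus a complexity term
  -- and can be absorbed. The conclusion follows from Ri - Rj ≤ S + (ri - rj) < 2S, with the
  -- constants 12, 12, 24 rounded up.
  have hAV : coefA n lam * V ≤ 1 / 4 * (ri - rj) + 1 / 4 * (1 / lam * Cj) := by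
    refine (mul_le_mul_of_nonneg_right hA hV0).trans ?_
    have e : lam / n * V = 1 / 4 * (1 / lam) * (4 * lam ^ 2 / n * V) := by field_simp
    rw [e]
    refine (mul_le_mul_of_nonneg_left hV2 (by positivity)).trans (le_of_eq ?_)
    field_simp
  have hBK : coefB n lam * (Ci + Cj + 2 * L) ≤
      4 * (1 / lam * Ci) + 4 * (1 / lam * Cj) + 8 * (1 / lam * L) :=
    (mul_le_mul_of_nonneg_right hB (by linarith)).trans (le_of_eq (by ring))
  have hκ : 0 ≤ 1 / lam := by positivity
  have hCi' := mul_nonneg hκ hCi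
  have hCj' := mul_nonneg hκ hCj
  have hL' := mul_nonneg hκ hc
  have e : 1 / lam * (12 * Ci + 12 * Cj + 24 * L) =
      12 * (1 / lam * Ci) + 12 * (1 / lam * Cj) + 24 * (1 / lam * L) := by ring
  rw [e]
  linarith

end Sample

/-! ### The selection scheme -/

section Scheme

variable {X Y G : Type*} [MeasurableSpace X] [MeasurableSpace Y] [MeasurableSpace G]

-- Induction on the room left between the current index and ⌊log n⌋, for an arbitrary starting
-- index.
omit [MeasurableSpace X] [MeasurableSpace Y] in
lemma exists_isRun (π : Measure G) (l : Y → Y → ℝ) (f : G → X → Y) (ε : ℝ) {n : ℕ}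
    (z : Fin n → X × Y) : ∃ (K : ℕ) (u : ℕ → ℕ), IsRun π l f ε z K u := by
  suffices H : ∀ m i : ℕ, ⌊Real.log n⌋₊ - i ≤ m → ∃ (K : ℕ) (u : ℕ → ℕ), u 0 = i ∧
      (∀ k < K, IsLeast (candidates π l f ε z (u k)) (u (k + 1))) ∧
      candidates π l f ε z (u K) = ∅ by
    obtain ⟨K, u, h1, h2, h3⟩ := H _ 0 le_rfl
    exact ⟨K, u, h1, h2, h3⟩
  intro m
  induction m with
  | zero =>
    intro i hi
    refine ⟨0, fun _ => i, rfl, by simp, Set.eq_empty_of_forall_notMem fun j hj => ?_⟩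
    have h1 : i < j := hj.1
    have h2 := Nat.le_floor hj.2.1
    omega
  | succ m ih =>
    intro i hi
    rcases Set.eq_empty_or_nonempty (candidates π l f ε z i) with h | h
    · exact ⟨0, fun _ => i, rfl, by simp, h⟩
    · obtain ⟨j, hj⟩ : ∃ j, IsLeast (candidates π l f ε z i) j :=
        ⟨sInf _, Nat.sInf_mem h, fun _ hk => Nat.sInf_le hk⟩
      have h1 := hj.1.1
      have h2 := Nat.le_floor hj.1.2.1
      obtain ⟨K, u, hu0, hu, hK⟩ := ih j (by omega)
      refine ⟨K + 1, fun k => Nat.casesOn k i u, rfl, fun k hk => ?_, hK⟩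
      cases k with
      | zero => simpa [hu0] using hj
      | succ k => exact hu k (by omega)

omit [MeasurableSpace X] [MeasurableSpace Y] in
/-- Along a run on which a functional decreases, a given `j` is either beaten by the final
temperature, or was rejected at a temperature that is beaten by the final one. -/
lemma IsRun.exists_rejected {π : Measure G} {l : Y → Y → ℝ} {f : G → X → Y} {ε : ℝ} {n : ℕ}
    {z : Fin n → X × Y} {K : ℕ} {u : ℕ → ℕ} (h : IsRun π l f ε z K u) {ϱ : ℕ → ℝ}
    (hdecr : ∀ k < K, ϱ (u (k + 1)) ≤ ϱ (u k)) {j : ℕ} (hj : 1 ≤ j) :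
    ϱ (u K) ≤ ϱ j ∨ ∃ i < j, j ∉ candidates π l f ε z i ∧ ϱ (u K) ≤ ϱ i := by
  classical
  have hle : ∀ k ≤ K, ϱ (u K) ≤ ϱ (u k) := fun k hk =>
    Nat.decreasingInduction (motive := fun k _ => ϱ (u K) ≤ ϱ (u k))
      (fun k hk ih => ih.trans (hdecr k hk)) le_rfl hk
  -- The last step of the run still below j. The next index is j itself, or exceeds it so that by
  -- minimality j was no candidate, or the run stopped with no candidates left.
  set k := Nat.findGreatest (fun k => u k < j) K with hk
  have hkK : k ≤ K := Nat.findGreatest_le K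
  have huk : u k < j := Nat.findGreatest_spec (P := fun k => u k < j) (Nat.zero_le K)
    (by rw [h.start]; exact hj)
  rcases hkK.lt_or_eq with hlt | heq
  · have hnot : ¬ u (k + 1) < j := Nat.findGreatest_is_greatest (P := fun k => u k < j)
      (Nat.lt_succ_self k) hlt
    rcases (not_lt.1 hnot).lt_or_eq with hj' | hj'
    · exact Or.inr ⟨u k, huk, fun hmem => absurd ((h.step k hlt).2 hmem) (not_le.2 hj'),
        hle k hkK⟩
    · exact Or.inl (hj' ▸ hle (k + 1) hlt)
  · exact Or.inr ⟨u k, huk, by rw [heq, h.stop_at]; exact Set.notMem_empty j, hle k hkK⟩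

/-! ### The oracle inequality -/

variable {P : Measure (X × Y)} [IsProbabilityMeasure P] {π : Measure G} [IsProbabilityMeasure π]
  {l : Y → Y → ℝ} {f : G → X → Y} {n : ℕ} {z : Fin n → X × Y} {c ε : ℝ}

/-- The ratio √e of consecutive temperatures lies in [3/2, 2]: the upper bound is what
`Deviation.risk_tilted_le` requires, the lower one makes λ_{j+1} - λ_j at least λ_{j+1}/4. -/
lemma GoodSample.risk_le_localPrior (h : GoodSample P π l f c z) (hn : 1 ≤ n) (hc : 0 ≤ c)
    (hq : BddMeas fun q : G × (X × Y) => l q.2.2 (f q.1 q.2.1)) {j : ℕ}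
    (hj : ((j + 1 : ℕ) : ℝ) ≤ Real.log n) :
    ∫ g, risk P l f g ∂(posterior π l f z (j + 1)) ≤ ∫ g, risk P l f g ∂(localPrior π P l f n j)
      + (1 / invTemp n (j + 1)) * (2 * c +
        2 * lgm₂ (localPrior π P l f n j) (localPrior π P l f n j)
          (fun g₁ g₂ => 128 * invTemp n j ^ 2 / n * sqDist P l f g₁ g₂)) := by
  have := isProbabilityMeasure_localPrior (P := P) (π := π) (n := n) hq j
  have hj' : (j : ℝ) ≤ Real.log n := le_trans (by simp) hj
  have h1 := h j j hj' hj'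
  rw [pairTemp, if_pos rfl] at h1
  have hlam := invTemp_pos hn j
  have hlam' := invTemp_pos hn (j + 1)
  obtain ⟨b1, b2⟩ := exp_half_bounds
  have hs := invTemp_succ n j
  have h2 := h1.risk_tilted_le hn hlam (invTemp_div_le hn hj')
    (invTemp_mono n (Nat.le_succ j)) (by rw [hs]; nlinarith) hc hq
  rw [← posterior_eq_tilted_localPrior hq] at h2
  have hell : 0 ≤ lgm₂ (localPrior π P l f n j) (localPrior π P l f n j)
      (fun g₁ g₂ => 128 * invTemp n j ^ 2 / n * sqDist P l f g₁ g₂) :=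
    lgm₂_nonneg ((BddMeas.sqDist hq).const_mul _)
      fun _ _ => mul_nonneg (by positivity) (sqDist_nonneg _ _)
  set ell := lgm₂ (localPrior π P l f n j) (localPrior π P l f n j)
      (fun g₁ g₂ => 128 * invTemp n j ^ 2 / n * sqDist P l f g₁ g₂)
  set Δ := (∫ g, risk P l f g ∂(posterior π l f z (j + 1))) -
    ∫ g, risk P l f g ∂(localPrior π P l f n j) with hΔ
  suffices H : Δ ≤ 1 / invTemp n (j + 1) * (2 * c + 2 * ell) by linarith
  rw [one_div, inv_mul_eq_div, le_div_iff₀ hlam']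
  rcases le_total Δ 0 with h0 | h0
  · nlinarith
  · have h3 : 1 / 4 * invTemp n (j + 1) ≤ invTemp n (j + 1) - invTemp n j := by
      rw [hs]; nlinarith
    nlinarith [mul_le_mul_of_nonneg_right h3 h0]

lemma BddMeas.disagreement [MeasurableEq Y] (hf : Measurable (fun q : G × X => f q.1 q.2)) :
    BddMeas fun p : G × G => disagreement P f p.1 p.2 := by
  have hg : ∀ φ : (G × G) × (X × Y) → G, Measurable φ →
      Measurable fun q : (G × G) × (X × Y) => f (φ q) q.2.1 := fun φ hφ =>
    hf.comp (f := fun q : (G × G) × (X × Y) => (φ q, q.2.1)) (hφ.prodMk (by fun_prop))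
  have hS : MeasurableSet {q : (G × G) × (X × Y) | f q.1.1 q.2.1 ≠ f q.1.2 q.2.1} :=
    ((hg (fun q => q.1.1) (by fun_prop)).prodMk (hg (fun q => q.1.2) (by fun_prop))
      measurableSet_diagonal).compl
  have hm : Measurable fun p : G × G => GibbsSelection.disagreement P f p.1 p.2 :=
    (measurable_measure_prodMk_left (ν := P) hS).ennreal_toReal
  exact ⟨hm, 1, fun p => by
    rw [GibbsSelection.disagreement, abs_of_nonneg measureReal_nonneg]
    exact measureReal_le_one⟩

lemma sqDist_le_disagreement [MeasurableEq Y] (hf : Measurable (fun q : G × X => f q.1 q.2))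
    (hq : BddMeas fun q : G × (X × Y) => l q.2.2 (f q.1 q.2.1))
    (hl01 : ∀ y y', 0 ≤ l y y' ∧ l y y' ≤ 1) (g₁ g₂ : G) :
    sqDist P l f g₁ g₂ ≤ disagreement P f g₁ g₂ := by
  have hg : ∀ g, Measurable fun q : X × Y => f g q.1 := fun g =>
    hf.comp (f := fun q : X × Y => (g, q.1)) (by fun_prop)
  have hS : MeasurableSet {p : X × Y | f g₁ p.1 ≠ f g₂ p.1} :=
    ((hg g₁).prodMk (hg g₂) measurableSet_diagonal).compl
  have hU : BddMeas fun p : X × Y => (l p.2 (f g₁ p.1) - l p.2 (f g₂ p.1)) ^ 2 :=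
    (BddMeas.lossDiffSq hq).comp (φ := fun p : X × Y => ((g₁, g₂), p)) (by fun_prop)
  rw [sqDist, disagreement, ← integral_indicator_one hS]
  refine integral_mono (hU.integrable P) ((integrable_const (1 : ℝ)).indicator hS) fun p => ?_
  by_cases hp : f g₁ p.1 = f g₂ p.1
  · have : p ∉ {p : X × Y | f g₁ p.1 ≠ f g₂ p.1} := fun hmem => hmem hp
    simp [hp]
  · have : p ∈ {p : X × Y | f g₁ p.1 ≠ f g₂ p.1} := hp
    rw [Set.indicator_of_mem this]
    exact (sq_le_one_iff_abs_le_one _).2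
      (abs_le.2 ⟨by linarith [(hl01 p.2 (f g₁ p.1)).1, (hl01 p.2 (f g₂ p.1)).2],
      by linarith [(hl01 p.2 (f g₁ p.1)).2, (hl01 p.2 (f g₂ p.1)).1]⟩)

/-- The total weight 26 of the log-Laplace terms in the oracle inequality is moved into the
exponent, 3328 = 26 · 128, so that the supremum there carries coefficient one. -/
lemma mul_lgm₂_sqDist_le_logLaplace [MeasurableEq Y]
    (hf : Measurable (fun q : G × X => f q.1 q.2))
    (hq : BddMeas fun q : G × (X × Y) => l q.2.2 (f q.1 q.2.1))
    (hl01 : ∀ y y', 0 ≤ l y y' ∧ l y y' ≤ 1) (i : ℕ) :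
    26 * lgm₂ (localPrior π P l f n i) (localPrior π P l f n i)
      (fun g₁ g₂ => 128 * invTemp n i ^ 2 / n * sqDist P l f g₁ g₂) ≤
      logLaplace π P l f n 3328 i := by
  have := isProbabilityMeasure_localPrior (P := P) (π := π) (n := n) hq i
  have hQ := BddMeas.sqDist (P := P) hq
  have hD := BddMeas.disagreement (P := P) (f := f) hf
  have h1 := nat_mul_lgm₂_le (μ := localPrior π P l f n i) (ν := localPrior π P l f n i)
    (h := fun g₁ g₂ => 128 * invTemp n i ^ 2 / n * sqDist P l f g₁ g₂) (hQ.const_mul _) 26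
  push_cast at h1
  refine h1.trans ?_
  rw [logLaplace, ← lgm₂_eq_log
    (h := fun g₁ g₂ => 3328 * invTemp n i ^ 2 / n * disagreement P f g₁ g₂) (hD.const_mul _)]
  refine lgm₂_mono (h := fun g₁ g₂ => 26 * (128 * invTemp n i ^ 2 / n * sqDist P l f g₁ g₂))
    (k := fun g₁ g₂ => 3328 * invTemp n i ^ 2 / n * disagreement P f g₁ g₂)
    ((hQ.const_mul _).const_mul _) (hD.const_mul _) fun g₁ g₂ => ?_
  have h2 := mul_le_mul_of_nonneg_left (sqDist_le_disagreement (P := P) hf hq hl01 g₁ g₂)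
    (by positivity : 0 ≤ 3328 * invTemp n i ^ 2 / n)
  refine le_trans (le_of_eq ?_) h2
  ring

lemma confTerm_nonneg (hn : 1 ≤ n) (hε : 0 < ε) (hε1 : ε < 1) : 0 ≤ confTerm n ε := by
  have hn0 : (0 : ℝ) < n := by positivity
  have hlog : 0 ≤ Real.log n := Real.log_nonneg (by exact_mod_cast hn)
  have h1 : 1 ≤ ε⁻¹ := (one_le_inv₀ hε).2 hε1.le
  rw [confTerm, Real.log_mul (Real.exp_pos 1).ne' hn0.ne', Real.log_exp]
  exact Real.log_nonneg (by nlinarith [sq_nonneg (Real.log n)])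

/-- With y = log(en) ≥ 2 the factor 3 is at most y², so 3y²ε⁻¹ ≤ (yε⁻¹)⁴. -/
lemma confTerm_le (hn : 1 ≤ n) (hlog : 1 ≤ Real.log n) (hε : 0 < ε) (hε1 : ε < 1) :
    confTerm n ε ≤ 4 * Real.log (Real.log (Real.exp 1 * n) * ε⁻¹) := by
  have hn0 : (0 : ℝ) < n := by positivity
  have h1 : 1 ≤ ε⁻¹ := (one_le_inv₀ hε).2 hε1.le
  have hy : 2 ≤ Real.log (Real.exp 1 * n) := by
    rw [Real.log_mul (Real.exp_pos 1).ne' hn0.ne', Real.log_exp]; linarith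
  set y := Real.log (Real.exp 1 * n)
  have h2 : (4 : ℝ) * Real.log (y * ε⁻¹) = Real.log ((y * ε⁻¹) ^ 4) := by
    rw [Real.log_pow]; norm_num
  rw [confTerm, h2]
  refine Real.log_le_log (by positivity) ?_
  have h3 : (3 : ℝ) ≤ y ^ 2 := by nlinarith
  have h4 : ε⁻¹ ≤ ε⁻¹ ^ 4 := le_self_pow₀ h1 (by norm_num)
  calc 3 * y ^ 2 * ε⁻¹ ≤ y ^ 2 * y ^ 2 * ε⁻¹ ^ 4 := by gcongr
    _ = (y * ε⁻¹) ^ 4 := by ring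

/-- The oracle inequality for the selected temperature. -/
lemma GoodSample.oracle_inequality [MeasurableEq Y] (h : GoodSample P π l f (confTerm n ε) z)
    (hn : 1 ≤ n) (hε : 0 < ε) (hε1 : ε < 1) (hf : Measurable (fun q : G × X => f q.1 q.2))
    (hq : BddMeas fun q : G × (X × Y) => l q.2.2 (f q.1 q.2.1))
    (hl01 : ∀ y y', 0 ≤ l y y' ∧ l y y' ≤ 1) {K : ℕ} {u : ℕ → ℕ} (hrun : IsRun π l f ε z K u)
    {j : ℕ} (hj : 1 ≤ j) (hjn : (j : ℝ) ≤ Real.log n) :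
    ∫ g, risk P l f g ∂(posterior π l f z (u K)) ≤
      (∫ g, risk P l f g ∂(localPrior π P l f n (j - 1)))
      + 3328 * (Real.log (Real.log (Real.exp 1 * n) * ε⁻¹) / invTemp n j)
      + 1 / invTemp n j * (Finset.range (j + 1)).sup' Finset.nonempty_range_add_one
        (logLaplace π P l f n 3328) := by
  have hc := confTerm_nonneg hn hε hε1
  have hκ : 0 < 1 / invTemp n j := one_div_pos.2 (invTemp_pos hn j)
  set S := (Finset.range (j + 1)).sup' Finset.nonempty_range_add_one
    (logLaplace π P l f n 3328) with hS
  set Λ := Real.log (Real.log (Real.exp 1 * n) * ε⁻¹) with hΛ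
  have hell : ∀ i ≤ j, lgm₂ (localPrior π P l f n i) (localPrior π P l f n i)
      (fun g₁ g₂ => 128 * invTemp n i ^ 2 / n * sqDist P l f g₁ g₂) ≤ S / 26 := fun i hi => by
    have h1 := mul_lgm₂_sqDist_le_logLaplace (P := P) (π := π) (n := n) hf hq hl01 i
    have h2 := Finset.le_sup' (logLaplace π P l f n 3328) (Finset.mem_range_succ_iff.2 hi)
    rw [← hS] at h2
    linarith
  have hC : ∀ i ≤ j, complexity π l f z i ≤ confTerm n ε + S / 26 := fun i hi =>
    (h.complexity_le hn hq (le_trans (by exact_mod_cast hi) hjn)).trans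
      (add_le_add_right (hell i hi) _)
  have hL : confTerm n ε ≤ 4 * Λ :=
    confTerm_le hn (le_trans (by exact_mod_cast hj) hjn) hε hε1
  obtain ⟨m, rfl⟩ : ∃ m, j = m + 1 := ⟨j - 1, by omega⟩
  have h1 := h.risk_le_localPrior hn hc hq hjn
  rw [Nat.add_sub_cancel]
  have hrej : ∫ g, risk P l f g ∂(posterior π l f z (u K)) ≤
      ∫ g, risk P l f g ∂(posterior π l f z (m + 1)) +
        1 / invTemp n (m + 1) * (48 * confTerm n ε + 24 / 26 * S) := by
    have hCm := hC (m + 1) le_rfl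
    have hCm0 := complexity_nonneg (π := π) (z := z) hq (m + 1)
    rcases hrun.exists_rejected (ϱ := fun i => ∫ g, risk P l f g ∂(posterior π l f z i))
      (fun k hk => h.risk_le_of_mem_candidates hn hc hq (hrun.step k hk).1) hj with
      h2 | ⟨i, hi, hrej, h2⟩
    · exact h2.trans (le_add_of_nonneg_right (mul_nonneg hκ.le (by linarith)))
    · refine h2.trans ((h.risk_le_of_notMem_candidates hn hc hq hi hjn hrej).trans ?_)
      refine add_le_add_right (mul_le_mul_of_nonneg_left ?_ hκ.le) _
      linarith [hC i hi.le]
  -- The shares of S add up to (2 + 24)/26 = 1, and 50 L ≤ 200 Λ is well within 3328 Λ.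
  have h3 : 2 * confTerm n ε + 2 * lgm₂ (localPrior π P l f n m) (localPrior π P l f n m)
      (fun g₁ g₂ => 128 * invTemp n m ^ 2 / n * sqDist P l f g₁ g₂)
      + (48 * confTerm n ε + 24 / 26 * S) ≤ 3328 * Λ + S := by
    linarith [hell m (Nat.le_succ m)]
  have h4 := mul_le_mul_of_nonneg_left h3 hκ.le
  have e : 3328 * (Λ / invTemp n (m + 1)) = 1 / invTemp n (m + 1) * (3328 * Λ) := by ring
  rw [e]
  linarith

end Scheme

end GibbsSelection

/-! ### The main theorem -/

theorem mainTheorem8 :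
    ∃ C : ℝ, 0 < C ∧
      ∀ (X Y G : Type*) [MeasurableSpace X] [MeasurableSpace Y] [MeasurableEq Y]
        [MeasurableSpace G]
        (P : Measure (X × Y)) [IsProbabilityMeasure P]
        (π : Measure G) [IsProbabilityMeasure π]
        (f : G → X → Y) (_ : Measurable (fun q : G × X => f q.1 q.2))
        (l : Y → Y → ℝ) (_ : Measurable (fun q : Y × Y => l q.1 q.2))
        (_ : ∀ y y', 0 ≤ l y y' ∧ l y y' ≤ 1)
        (n : ℕ) (_ : 1 ≤ n) (ε : ℝ) (_ : 0 < ε),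
        -- the scheme is finite, whatever the sample
        (∀ z : Fin n → X × Y, ∃ (K : ℕ) (u : ℕ → ℕ), GibbsSelection.IsRun π l f ε z K u) ∧
        -- guarantees with probability at least `1 - ε` over the sample
        ∃ E : Set (Fin n → X × Y), MeasurableSet E ∧
          1 - ε ≤ (Measure.pi (fun _ : Fin n => P)).real E ∧
          ∀ z ∈ E, ∀ (K : ℕ) (u : ℕ → ℕ), GibbsSelection.IsRun π l f ε z K u →
            (∀ k : ℕ, 1 ≤ k → k ≤ K →
              ∫ g, GibbsSelection.risk P l f g ∂(GibbsSelection.posterior π l f z (u k)) ≤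
                ∫ g, GibbsSelection.risk P l f g
                  ∂(GibbsSelection.posterior π l f z (u (k - 1)))) ∧
            ∀ j : ℕ, 1 ≤ j → (j : ℝ) ≤ Real.log n →
              ∫ g, GibbsSelection.risk P l f g ∂(GibbsSelection.posterior π l f z (u K)) ≤
                (∫ g, GibbsSelection.risk P l f g
                  ∂(GibbsSelection.localPrior π P l f n (j - 1)))
                + C * (Real.log (Real.log (Real.exp 1 * n) * ε⁻¹)
                    / GibbsSelection.invTemp n j)
                + 1 / GibbsSelection.invTemp n j *
                  (Finset.range (j + 1)).sup' Finset.nonempty_range_add_one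
                    (GibbsSelection.logLaplace π P l f n C) := by
  refine ⟨3328, by norm_num, ?_⟩
  intro X Y G _ _ _ _ P _ π _ f hf l hl hl01 n hn ε hε
  refine ⟨GibbsSelection.exists_isRun π l f ε, ?_⟩
  have hq := GibbsSelection.BddMeas.loss hf hl hl01
  rcases le_or_gt 1 ε with hε1 | hε1
  -- For ε ≥ 1 the probability requirement is void, so the empty event will do; L ≥ 0 is only
  -- guaranteed below for ε < 1.
  · exact ⟨∅, MeasurableSet.empty, by simpa using hε1, fun z hz => absurd hz (Set.notMem_empty z)⟩
  obtain ⟨hmeas, hprob⟩ := GibbsSelection.measure_goodSample (P := P) (π := π) hn hq hl01 hε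
  refine ⟨_, hmeas, hprob, fun z hz K u hrun => ⟨fun k hk hkK => ?_, fun j hj hjn => ?_⟩⟩
  · obtain ⟨k, rfl⟩ : ∃ m, k = m + 1 := ⟨k - 1, by omega⟩
    exact GibbsSelection.GoodSample.risk_le_of_mem_candidates hz hn
      (GibbsSelection.confTerm_nonneg hn hε hε1) hq (hrun.step k hkK).1
  · exact GibbsSelection.GoodSample.oracle_inequality hz hn hε hε1 hf hq hl01 hrun hj hjn
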